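/- **One-sided ESN-type theorem for inverse semigroupoids.** (i) Inverse semigroupoids and morphisms form a category, li-constellations with right inverses and inductive radiants form a category, and these two categories are isomorphic. (ii) Inverse semigroupoids and premorphisms form a category, li-constellations with right inverses and inductive preradiants form a category, and these two categories are isomorphic. In all four categories the arrows are functions between the underlying sets, with the usual identities and composition. The notions are the following. *Semigroupoids.* A semigroupoid is a set $S$ with a partially defined binary operation such that, for all $s,t,r\in S$, if ($st$ and $tr$ are defined), or ($st$ and $(st)r$ are defined), or ($tr$ and $s(tr)$ are defined), then $st$, $tr$, $(st)r$, $s(tr)$ are all defined and $(st)r=s(tr)$. It is an inverse semigroupoid if for every $s$ there is exactly one $s^{-1}\in S$ such that $ss^{-1}$ and $s^{-1}s$ are defined, $ss^{-1}s=s$ and $s^{-1}ss^{-1}=s^{-1}$; then put $s^+=ss^{-1}$, and write $s\le t$ if $s^+t$ is defined and equal to $s$. Let $\varphi:S\to S'$ be a function between inverse semigroupoids. It is a morphism if, whenever $st$ is defined, $\varphi(s)\varphi(t)$ is defined and equals $\varphi(st)$. It is a premorphism if, whenever $st$ is defined, $\varphi(s)\varphi(t)$ and $\varphi(s)^+\varphi(st)$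 are defined and equal, and $\varphi(s)^+\le\varphi(s^+)$ for all $s$. *Li-constellations.* A left constellation is a set $T$ with a partially defined binary operation and a map $x\mapsto x^+$, with $T^+=\{x^+:x\in T\}$, such that: $xy$ and $yz$ are defined if and only if $yz$ and $x(yz)$ are defined; in this case $(xy)z$ is defined and $x(yz)=(xy)z$; for $e\in T^+$, $ex$ is defined and equal to $x$ if and only if $e=x^+$; if $e\in T^+$ and $xe$ is defined, then $xe=x$. It has right inverses if for every $x$ there is $y$ such that $xy$ is defined and $xy=x^+$. Given a partial order $\le$ on $T$ and $e\in T^+$, the corestriction $x|e$ is the maximum, if it exists, of $\{y\le x: ye\text{ is defined}\}$, and $x|e\ne\emptyset$ means that it exists; when $e\le x^+$, the restriction $e|x$ is the element $z\le x$ with $z^+=e$. An li-constellation (locally inductive left constellation) is a left constellation with a partial order such that, for all $x,x',y,y'\in T$ and $e,f\in T^+$: 1. if $x\le y$, $x'\le y'$ and $xx'$, $yy'$ are defined, then $xx'\le yy'$; 2. if $x\le y$, then $x^+\le y^+$; 3. if $e\le x^+$, there is exactly one $z\le x$ with $z^+=e$; 4. the set $\{y\le x: ye\text{ is defined}\}$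 is empty or has a maximum; 5. if $xy$ is defined, then $(xy)|e\neq\emptyset$ if and only if $y|e\neq\emptyset$; 6. if $f\le e$, then $x|e\ne\emptyset$ if and only if $x|f\neq\emptyset$; 7. if $xy$ is defined and $(xy)|e\ne\emptyset$, then $((xy)|e)^+=(x|(y|e)^+)^+$; 8. if $e\le f$, the restriction $e|f$ and the corestriction $e|f$ coincide; 9. every connected component of the poset $T^+$ (class of the equivalence relation generated by $\le$) is a meet-semilattice; the corestriction $e|f$ exists if and only if $e$ and $f$ lie in the same component, and it is then their meet. *Radiants.* Let $\varphi:T\to L$ be a function between li-constellations. Consider the conditions, for $x,y\in T$ and $e\in T^+$: (a) if $x\le y$, then $\varphi(x)\le\varphi(y)$; (b) if $x|e\ne\emptyset$, then $\varphi(x)|\varphi(e)\neq\emptyset$ and $\varphi(x|e)=\varphi(x)|\varphi(e)$. It is an inductive radiant if (a) and (b) hold, $\varphi(x)^+=\varphi(x^+)$ for all $x$, and, whenever $xy$ is defined, $\varphi(x)\varphi(y)$ is defined and equals $\varphi(xy)$. It is an inductive preradiant if (a) and (b) hold, $\varphi(x)^+\le\varphi(x^+)$ for all $x$, $\varphi(e|x)^+=\varphi(e)|\varphi(x)^+$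 (a corestriction) whenever $e\le x^+$, and, whenever $xy$ is defined, $\varphi(x)\otimes\varphi(y)$ and $\varphi(x)^+\otimes\varphi(xy)$ are defined and equal, where $s\otimes t=(s|t^+)t$, defined when $s|t^+\neq\emptyset$. -/

import Mathlib

open CategoryTheory

universe u

namespace ESN

/-- A set with a partially defined binary operation: `Comp s t` says that `st` is defined, and
`mul s t h` is then the product `st`. -/
class PartialMul (S : Type u) where
  Comp : S → S → Prop
  mul : ∀ s t : S, Comp s t → S

open PartialMul

/-- A semigroupoid in the sense of Exel. -/
class Semigroupoid (S : Type u) extends PartialMul S where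
  assoc : ∀ s t r : S,
    ((Comp s t ∧ Comp t r) ∨ (∃ h : Comp s t, Comp (mul s t h) r) ∨
      (∃ h : Comp t r, Comp s (mul t r h))) →
    ∃ (hst : Comp s t) (htr : Comp t r)
      (h₁ : Comp (mul s t hst) r) (h₂ : Comp s (mul t r htr)),
      mul (mul s t hst) r h₁ = mul s (mul t r htr) h₂

/-- `t` is a pseudo-inverse of `s`: both `st` and `ts` are defined, `sts = s` and `tst = t`. -/
def IsPseudoInverse {S : Type u} [PartialMul S] (s t : S) : Prop :=
  ∃ (hst : Comp s t) (hts : Comp t s),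
    (∃ h : Comp (mul s t hst) s, mul (mul s t hst) s h = s) ∧
    (∃ h : Comp (mul t s hts) t, mul (mul t s hts) t h = t)

/-- An inverse semigroupoid: every element has exactly one pseudo-inverse. -/
class InverseSemigroupoid (S : Type u) extends Semigroupoid S where
  existsUnique_pseudoInverse : ∀ s : S, ∃! t : S, IsPseudoInverse s t

namespace InverseSemigroupoid

variable {S T : Type u} [InverseSemigroupoid S] [InverseSemigroupoid T]

/-- The pseudo-inverse `s⁻¹`. -/
noncomputable def inv (s : S) : S := (existsUnique_pseudoInverse s).choose

theorem isPseudoInverse_inv (s : S) : IsPseudoInverse s (inv s) :=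
  (existsUnique_pseudoInverse s).choose_spec.1

theorem comp_inv (s : S) : Comp s (inv s) := (isPseudoInverse_inv s).1

/-- The left restriction operation `s⁺ = s s⁻¹` of an inverse semigroupoid. -/
noncomputable def plus (s : S) : S := mul s (inv s) (comp_inv s)

/-- The natural partial order: `s ≤ t` iff `s⁺t` is defined and `s⁺t = s`. -/
def NatLE (s t : S) : Prop := ∃ h : Comp (plus s) t, mul (plus s) t h = s

/-- A morphism: if `st` is defined, then so is `φ(s)φ(t)`, and `φ(st) = φ(s)φ(t)`. -/
def IsMorphism (φ : S → T) : Prop :=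
  ∀ (s t : S) (h : Comp s t), ∃ h' : Comp (φ s) (φ t), φ (mul s t h) = mul (φ s) (φ t) h'

/-- A premorphism: if `st` is defined, then `φ(s)φ(t)` and `φ(s)⁺φ(st)` are defined and equal;
moreover `φ(s)⁺ ≤ φ(s⁺)`. -/
structure IsPremorphism (φ : S → T) : Prop where
  map_mul : ∀ (s t : S) (h : Comp s t),
    ∃ (h₁ : Comp (φ s) (φ t)) (h₂ : Comp (plus (φ s)) (φ (mul s t h))),
      mul (φ s) (φ t) h₁ = mul (plus (φ s)) (φ (mul s t h)) h₂
  plus_le : ∀ s : S, NatLE (plus (φ s)) (φ (plus s))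

end InverseSemigroupoid

/-- A left constellation. Here `Set.range plus` is `T⁺`. -/
class LeftConstellation (T : Type u) extends PartialMul T where
  plus : T → T
  comp_iff : ∀ x y z : T,
    (Comp x y ∧ Comp y z) ↔ ∃ h : Comp y z, Comp x (mul y z h)
  assoc : ∀ (x y z : T) (hxy : Comp x y) (hyz : Comp y z),
    ∃ (h₁ : Comp (mul x y hxy) z) (h₂ : Comp x (mul y z hyz)),
      mul x (mul y z hyz) h₂ = mul (mul x y hxy) z h₁
  left_unit_iff : ∀ e ∈ Set.range plus, ∀ x : T,
    (∃ h : Comp e x, mul e x h = x) ↔ e = plus x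
  right_unit : ∀ e ∈ Set.range plus, ∀ (x : T) (h : Comp x e), mul x e h = x

/-- `x` and `y` lie in the same connected component of the poset `X`: they are joined by a finite
zigzag of comparable elements. -/
def Connected {X : Type u} [PartialOrder X] (x y : X) : Prop :=
  Relation.EqvGen (fun a b : X => a ≤ b) x y

/-- Every pair of elements has a meet. -/
def IsMeetSemilattice (X : Type u) [PartialOrder X] : Prop :=
  ∀ x y : X, ∃ z : X, IsGLB {x, y} z

/-- Every connected component is a meet-semilattice. -/
def IsLocalMeetSemilattice (X : Type u) [PartialOrder X] : Prop :=
  ∀ x : X, IsMeetSemilattice {y : X // Connected y x}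

section Constellations

variable {T L : Type u} [LeftConstellation T] [PartialOrder T] [LeftConstellation L]
  [PartialOrder L]

open LeftConstellation

variable (T) in
/-- The set `T⁺` of all the elements `x⁺`. -/
abbrev Plus : Set T := Set.range (plus : T → T)

/-- `z` satisfies the conditions that define the restriction `e|x`. -/
def IsRestriction (e x z : T) : Prop := z ≤ x ∧ plus z = e

/-- `z` is the corestriction `x|e`, the maximum of the `y ≤ x` such that `ye` is defined. -/
def IsCorestriction (x e z : T) : Prop := IsGreatest {y : T | y ≤ x ∧ Comp y e} z

/-- `x|e ≠ ∅`. -/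
def HasCorestriction (x e : T) : Prop := ∃ z : T, IsCorestriction x e z

/-- The pseudo-product `s ⊗ t = (s|t⁺)t` is defined and equal to `r`. -/
def IsPseudoProduct (s t r : T) : Prop :=
  ∃ a : T, IsCorestriction s (plus t) a ∧ ∃ h : Comp a t, mul a t h = r

variable (T) in
/-- A left constellation with a partial order is locally inductive. -/
structure IsLocallyInductive : Prop where
  mul_le_mul : ∀ (x y x' y' : T) (h : Comp x x') (h' : Comp y y'),
    x ≤ y → x' ≤ y' → mul x x' h ≤ mul y y' h'
  plus_le_plus : ∀ x y : T, x ≤ y → plus x ≤ plus y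
  restriction : ∀ e ∈ Plus T, ∀ x : T, e ≤ plus x → ∃! z : T, IsRestriction e x z
  corestriction : ∀ e ∈ Plus T, ∀ x : T,
    {y : T | y ≤ x ∧ Comp y e} = ∅ ∨ HasCorestriction x e
  corestriction_mul : ∀ e ∈ Plus T, ∀ (x y : T) (h : Comp x y),
    HasCorestriction (mul x y h) e ↔ HasCorestriction y e
  corestriction_le : ∀ e ∈ Plus T, ∀ f ∈ Plus T, f ≤ e → ∀ x : T,
    HasCorestriction x e ↔ HasCorestriction x f
  /-- `((xy)|e)⁺ = (x|(y|e)⁺)⁺` whenever `(xy)|e ≠ ∅`. -/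
  plus_corestriction_mul : ∀ e ∈ Plus T, ∀ (x y : T) (h : Comp x y) (z : T),
    IsCorestriction (mul x y h) e z →
    ∃ w v : T, IsCorestriction y e w ∧ IsCorestriction x (plus w) v ∧ plus z = plus v
  restriction_eq_corestriction : ∀ e ∈ Plus T, ∀ f ∈ Plus T, e ≤ f → ∀ z : T,
    IsRestriction e f z ↔ IsCorestriction e f z
  localMeetSemilattice : IsLocalMeetSemilattice (Plus T)
  /-- The (partial) meet operation of `T⁺`, defined on the pairs of elements of the same connected
  component, is the corestriction; in particular `e|f ≠ ∅` exactly if `e` and `f` are in the same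
  component. A lower bound of `e` and `f` in `T⁺` lies in their component, so that the meet in the
  component is the meet in `T⁺`. -/
  corestriction_iff_meet : ∀ (e f : Plus T) (z : T),
    IsCorestriction (e : T) (f : T) z ↔
      Connected e f ∧ ∃ w : Plus T, (w : T) = z ∧ IsGLB {e, f} w

variable (T) in
/-- Every `x` has some `y` such that `xy` is defined and `xy = x⁺`. -/
def HasRightInverses : Prop := ∀ x : T, ∃ (y : T) (h : Comp x y), mul x y h = plus x

/-- Inductive radiants. -/
structure IsInductiveRadiant (φ : T → L) : Prop where
  map_mul : ∀ (x y : T) (h : Comp x y),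
    ∃ h' : Comp (φ x) (φ y), φ (mul x y h) = mul (φ x) (φ y) h'
  map_plus : ∀ x : T, plus (φ x) = φ (plus x)
  map_le : ∀ x y : T, x ≤ y → φ x ≤ φ y
  map_corestriction : ∀ (x : T), ∀ e ∈ Plus T, ∀ z : T,
    IsCorestriction x e z → IsCorestriction (φ x) (φ e) (φ z)

/-- Inductive preradiants. -/
structure IsInductivePreradiant (φ : T → L) : Prop where
  /-- If `xy` is defined, then `φ(x) ⊗ φ(y)` and `φ(x)⁺ ⊗ φ(xy)` are defined and equal. -/
  map_mul : ∀ (x y : T) (h : Comp x y),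
    ∃ r : L, IsPseudoProduct (φ x) (φ y) r ∧ IsPseudoProduct (plus (φ x)) (φ (mul x y h)) r
  plus_le : ∀ x : T, plus (φ x) ≤ φ (plus x)
  map_le : ∀ x y : T, x ≤ y → φ x ≤ φ y
  map_corestriction : ∀ (x : T), ∀ e ∈ Plus T, ∀ z : T,
    IsCorestriction x e z → IsCorestriction (φ x) (φ e) (φ z)
  /-- `φ(e|x)⁺ = φ(e)|φ(x)⁺` whenever `e ≤ x⁺`. -/
  plus_map_restriction : ∀ (x : T), ∀ e ∈ Plus T, e ≤ plus x → ∀ z : T,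
    IsRestriction e x z → IsCorestriction (φ e) (plus (φ x)) (plus (φ z))

end Constellations

/-- An inverse semigroupoid with its underlying set. -/
structure InvSgpd : Type (u + 1) where
  carrier : Type u
  [str : InverseSemigroupoid carrier]

/-- A locally inductive left constellation with right inverses, with its underlying set. -/
structure LIConstRightInv : Type (u + 1) where
  carrier : Type u
  [str : LeftConstellation carrier]
  [order : PartialOrder carrier]
  locallyInductive : IsLocallyInductive carrier
  hasRightInverses : HasRightInverses carrier

attribute [instance] InvSgpd.str LIConstRightInv.str LIConstRightInv.order

/-- A collection of objects with underlying sets, together with a choice, for any two objects, of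
some of the functions between their underlying sets. -/
structure FunctionClass : Type (u + 2) where
  Obj : Type (u + 1)
  carrier : Obj → Type u
  IsHom : ∀ {X Y : Obj}, (carrier X → carrier Y) → Prop

/-- The chosen functions form a category: they contain the identity functions and are closed under
the composition of functions. -/
structure FunctionClass.FormsCategory (K : FunctionClass.{u}) : Prop where
  id_isHom : ∀ X : K.Obj, K.IsHom (X := X) (Y := X) id
  comp_isHom : ∀ {X Y Z : K.Obj} (f : K.carrier X → K.carrier Y) (g : K.carrier Y → K.carrier Z),
    K.IsHom f → K.IsHom g → K.IsHom (X := X) (Y := Z) (g ∘ f)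

/-- The category of the given objects and of the chosen functions, with the usual composition. -/
def FunctionClass.FormsCategory.cat {K : FunctionClass.{u}} (h : K.FormsCategory) :
    Cat.{u, u + 1} :=
  @Cat.of K.Obj
    { Hom := fun X Y => {f : K.carrier X → K.carrier Y // K.IsHom f}
      id := fun X => ⟨id, h.id_isHom X⟩
      comp := fun f g => ⟨g.1 ∘ f.1, h.comp_isHom f.1 g.1 f.2 g.2⟩ }

/-- Inverse semigroupoids and morphisms. -/
def invSgpdMor : FunctionClass.{u} where
  Obj := InvSgpd.{u}
  carrier := InvSgpd.carrier
  IsHom := fun φ => InverseSemigroupoid.IsMorphism φ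

/-- Inverse semigroupoids and premorphisms. -/
def invSgpdPremor : FunctionClass.{u} where
  Obj := InvSgpd.{u}
  carrier := InvSgpd.carrier
  IsHom := fun φ => InverseSemigroupoid.IsPremorphism φ

/-- Li-constellations with right inverses and inductive radiants. -/
def liConstRadiant : FunctionClass.{u} where
  Obj := LIConstRightInv.{u}
  carrier := LIConstRightInv.carrier
  IsHom := fun φ => IsInductiveRadiant φ

/-- Li-constellations with right inverses and inductive preradiants. -/
def liConstPreradiant : FunctionClass.{u} where
  Obj := LIConstRightInv.{u}
  carrier := LIConstRightInv.carrier
  IsHom := fun φ => IsInductivePreradiant φ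

end ESN

/-! Adjoining a zero as the value of every undefined product turns an inverse semigroupoid `S` into
an inverse semigroup `S⁰` in which `ab ≠ 0` and `bc ≠ 0` imply `abc ≠ 0`
(`AdjoinZero.mul_mul_ne_zero`). On the nonzero elements of `S⁰` the constellation notions become
equations: the constellation product of `x` and `y` is `xy` when `xy⁺ = x`, the corestriction `x|e`
is `xe`, the restriction `e|x` is `ex`, the pseudo-product `x ⊗ y` is `xy`, and two idempotents are
connected exactly when their product is nonzero. The axioms of an li-constellation then become short
computations with commuting idempotents (`Const.isLocallyInductive`).

Conversely, the pseudo-product of an li-constellation is associative by the axioms on corestrictions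
of products (`isPseudoProduct_assoc`). Its idempotents are the elements of `T⁺`, which commute
because their product is a meet, and right inverses can be cut down to two-sided ones
(`exists_inverse`). The two constructions keep the underlying set and undo each other as equalities
of structures (`objEquiv`).

It remains to compare functions on the same sets: radiants are the morphisms and preradiants the
premorphisms (`isInductiveRadiant_iff`, `isInductivePreradiant_iff`). Both equivalences rest on `xy
= (x|y⁺)y`, which reduces an arbitrary product to a corestriction followed by a constellation
product. -/

namespace ESN

/-! ### Inverse semigroups -/

/-- An inverse semigroup, described as a regular semigroup with commuting idempotents. -/
class InverseSemigroup (M : Type*) [Semigroup M] [Inv M] : Prop where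
  mul_inv_mul : ∀ a : M, a * a⁻¹ * a = a
  inv_mul_inv : ∀ a : M, a⁻¹ * a * a⁻¹ = a⁻¹
  idem_comm : ∀ e f : M, e * e = e → f * f = f → e * f = f * e

/-- Once products of idempotents are idempotent, `ef` and `fe` are both inverses of `ef`, hence
equal. -/
theorem InverseSemigroup.of_unique {M : Type*} [Semigroup M] [Inv M]
    (h₁ : ∀ a : M, a * a⁻¹ * a = a) (h₂ : ∀ a : M, a⁻¹ * a * a⁻¹ = a⁻¹)
    (h : ∀ a b c : M, a * b * a = a → b * a * b = b → a * c * a = a → c * a * c = c → b = c) :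
    InverseSemigroup M := by
  have key : ∀ e f : M, e * e = e → f * f = f → e * f * (e * f) = e * f := by
    intro e f he hf
    have a₁ := h₁ (e * f)
    have a₂ := h₂ (e * f)
    -- If `x` is an inverse of `ef`, so is `fxe`. Hence `x = fxe`, which makes `x` idempotent and so
    -- its own inverse; as `ef` is another inverse of `x`, it equals `x`.
    generalize (e * f)⁻¹ = x at a₁ a₂
    have hx : f * x * e = x := by
      refine h (e * f) _ _ ?_ ?_ a₁ a₂ <;> grind
    have hxx : x * x = x := by grind
    have : e * f = x := by
      refine h x _ _ a₂ a₁ ?_ ?_ <;> grind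
    grind
  refine ⟨h₁, h₂, fun e f he hf => ?_⟩
  have k₁ := key e f he hf
  have k₂ := key f e hf he
  refine h (e * f) _ _ ?_ ?_ ?_ ?_ <;> grind

namespace InverseSemigroup

section

variable {M : Type*} [Semigroup M] [Inv M] [InverseSemigroup M]

/-- Commuting `ab` with `ac` gives `ab = ac`, likewise `ba = ca`, and then `b = bab = cac = c`. -/
theorem inv_unique {a b c : M} (h₁ : a * b * a = a) (h₂ : b * a * b = b) (h₃ : a * c * a = a)
    (h₄ : c * a * c = c) : b = c := by
  have hl := idem_comm (a * b) (a * c) (by grind) (by grind)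
  have hr := idem_comm (b * a) (c * a) (by grind) (by grind)
  grind

theorem eq_inv {a b : M} (h₁ : a * b * a = a) (h₂ : b * a * b = b) : b = a⁻¹ :=
  inv_unique h₁ h₂ (mul_inv_mul a) (inv_mul_inv a)

theorem inv_of_idem {e : M} (he : e * e = e) : e⁻¹ = e :=
  (eq_inv (by grind) (by grind)).symm

theorem mul_inv_idem (a : M) : a * a⁻¹ * (a * a⁻¹) = a * a⁻¹ := by
  have := mul_inv_mul a; grind

theorem inv_mul_idem (a : M) : a⁻¹ * a * (a⁻¹ * a) = a⁻¹ * a := by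
  have := mul_inv_mul a; grind

theorem mul_inv_rev (a b : M) : (a * b)⁻¹ = b⁻¹ * a⁻¹ := by
  have h := idem_comm (a⁻¹ * a) (b * b⁻¹) (inv_mul_idem a) (mul_inv_idem b)
  have ha := mul_inv_mul a
  have hb := mul_inv_mul b
  have ha' := inv_mul_inv a
  have hb' := inv_mul_inv b
  refine (eq_inv ?_ ?_).symm
  · calc a * b * (b⁻¹ * a⁻¹) * (a * b) = a * ((b * b⁻¹) * (a⁻¹ * a)) * b := by grind
      _ = a * b := by rw [← h]; grind
  · calc b⁻¹ * a⁻¹ * (a * b) * (b⁻¹ * a⁻¹) = b⁻¹ * ((a⁻¹ * a) * (b * b⁻¹)) * a⁻¹ := by grind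
      _ = b⁻¹ * a⁻¹ := by rw [h]; grind

/-- `a⁺ = a a⁻¹`. -/
def dom (a : M) : M := a * a⁻¹

theorem dom_idem (a : M) : dom a * dom a = dom a := mul_inv_idem a

theorem dom_mul_self (a : M) : dom a * a = a := mul_inv_mul a

theorem dom_of_idem {e : M} (he : e * e = e) : dom e = e := by
  rw [dom, inv_of_idem he, he]

theorem dom_dom (a : M) : dom (dom a) = dom a := dom_of_idem (dom_idem a)

theorem dom_comm {e : M} (he : e * e = e) (a : M) : e * dom a = dom a * e :=
  idem_comm _ _ he (dom_idem a)

/-- `(ab)⁺ = (ab⁺)⁺`. -/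
theorem dom_mul_dom (a b : M) : dom (a * dom b) = dom (a * b) := by
  have h := dom_idem b
  have := mul_inv_rev a (dom b)
  rw [inv_of_idem h] at this
  change a * dom b * (a * dom b)⁻¹ = a * b * (a * b)⁻¹
  rw [this, mul_inv_rev]
  unfold dom at *
  grind

theorem dom_idem_mul {e : M} (he : e * e = e) (a : M) : dom (e * a) = e * dom a := by
  rw [← dom_mul_dom, dom_of_idem]
  have := dom_comm he a
  have := dom_idem a
  grind

/-- Slides an idempotent from the right of `a` to its left, by commuting `e` with `a⁻¹a`. Hence the
order defined by left multiplication also contains the right multiples by idempotents. -/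
theorem mul_idem {e : M} (he : e * e = e) (a : M) : a * e = dom (a * e) * a := by
  have := idem_comm _ _ he (inv_mul_idem a)
  have := mul_inv_mul a
  rw [dom, mul_inv_rev, inv_of_idem he]
  grind

theorem dom_mul_of_eq {e a b : M} (he : e * e = e) (h : a = e * b) : dom a * b = a := by
  have := dom_idem_mul he b
  have := dom_mul_self b
  grind

/-- The natural partial order. -/
def Le (a b : M) : Prop := dom a * b = a

theorem le_of_idem_mul {e : M} (he : e * e = e) (a : M) : Le (e * a) a := dom_mul_of_eq he rfl

theorem le_of_mul_idem {e : M} (he : e * e = e) (a : M) : Le (a * e) a := (mul_idem he a).symm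

theorem Le.refl (a : M) : Le a a := dom_mul_self a

theorem Le.trans {a b c : M} (h : Le a b) (h' : Le b c) : Le a c := by
  have : dom a = dom a * dom b := by
    rw [← dom_idem_mul (dom_idem a), h]
  unfold Le at *; grind

theorem Le.dom_eq {a b : M} (h : Le a b) : dom a = dom a * dom b := by
  rw [← dom_idem_mul (dom_idem a), h]

theorem Le.antisymm {a b : M} (h : Le a b) (h' : Le b a) : a = b := by
  have := h.dom_eq
  have := h'.dom_eq
  have := dom_comm (dom_idem a) b
  unfold Le at *; grind

theorem Le.dom_le {a b : M} (h : Le a b) : Le (dom a) (dom b) := by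
  rw [Le, dom_dom, ← h.dom_eq]

/-- For `a ≤ b` also `a = b a⁻¹ a`. -/
theorem Le.exists_right {a b : M} (h : Le a b) : ∃ e : M, e * e = e ∧ a = b * e := by
  refine ⟨(dom a * b)⁻¹ * (dom a * b), inv_mul_idem _, ?_⟩
  have h₁ := dom_comm (dom_idem a) b
  have h₂ := dom_idem a
  rw [mul_inv_rev, inv_of_idem h₂]
  have h₃ := dom_mul_self b
  have h₄ : dom b = b * b⁻¹ := rfl
  unfold Le at h
  grind

theorem Le.mul {a b c d : M} (h : Le a b) (h' : Le c d) : Le (a * c) (b * d) := by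
  obtain ⟨e, he, rfl⟩ := h.exists_right
  have hd : e * dom c * (e * dom c) = e * dom c := by
    have := dom_comm he c
    have := dom_idem c
    grind
  -- With `a = be` and `c = c⁺d`, both idempotents meet between `b` and `d`, from where `mul_idem`
  -- moves them to the front.
  have h₁ : b * e * c = b * (e * dom c) * d := by
    unfold Le at h'; grind
  rw [h₁, mul_idem hd b, mul_assoc]
  exact le_of_idem_mul (dom_idem _) _

theorem Le.of_idem {e a : M} (he : e * e = e) (h : Le a e) : a * a = a := by
  have := dom_idem a
  have := dom_comm he a
  unfold Le at *; grind

theorem le_iff_of_idem {e f : M} (he : e * e = e) : Le e f ↔ e * f = e := by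
  rw [Le, dom_of_idem he]

theorem mul_dom_mul {a b : M} : a * dom b * b = a * b := by
  rw [mul_assoc, dom_mul_self]

theorem Le.mul_dom_le {a b : M} (h : Le a b) : dom b * a = a := by
  calc dom b * a = dom b * dom a * a := by rw [mul_assoc, dom_mul_self]
    _ = a := by rw [dom_comm (dom_idem b), ← h.dom_eq, dom_mul_self]

end

end InverseSemigroup

/-! ### Adjoining a zero to a semigroupoid -/

open PartialMul

/-- A set with a partial multiplication together with a new element `0`. -/
def AdjoinZero (S : Type u) : Type u := Option S

namespace AdjoinZero

instance {S : Type u} : Zero (AdjoinZero S) := ⟨(none : Option S)⟩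

/-- The inclusion of a set with a partial multiplication. -/
@[coe] def of {S : Type u} (s : S) : AdjoinZero S := (some s : Option S)

instance {S : Type u} : Coe S (AdjoinZero S) := ⟨of⟩

theorem of_ne_zero {S : Type u} (s : S) : (s : AdjoinZero S) ≠ 0 := Option.some_ne_none s

theorem of_inj {S : Type u} {s t : S} : (s : AdjoinZero S) = t ↔ s = t := Option.some_inj

@[elab_as_elim]
theorem ind {S : Type u} {P : AdjoinZero S → Prop} (h₀ : P 0) (h₁ : ∀ s : S, P s) (a) : P a :=
  match a with
  | none => h₀
  | some s => h₁ s

theorem exists_of {S : Type u} {a : AdjoinZero S} (h : a ≠ 0) : ∃ s : S, (s : AdjoinZero S) = a := by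
  induction a using ind with
  | h₀ => exact absurd rfl h
  | h₁ s => exact ⟨s, rfl⟩

open Classical in
/-- The partial multiplication, with value `0` where it is not defined. -/
noncomputable instance {S : Type u} [PartialMul S] : Mul (AdjoinZero S) :=
  ⟨fun a b => match a, b with
    | some s, some t => if h : Comp s t then of (mul s t h) else 0
    | _, _ => 0⟩

section PartialMul

variable {S : Type u} [PartialMul S]

theorem zero_mul (a : AdjoinZero S) : 0 * a = 0 := rfl

theorem mul_zero (a : AdjoinZero S) : a * 0 = 0 := by
  cases a <;> rfl

theorem of_mul {s t : S} (h : Comp s t) : (s : AdjoinZero S) * t = mul s t h := dif_pos h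

theorem of_mul_of_not {s t : S} (h : ¬ Comp s t) : (s : AdjoinZero S) * t = 0 := dif_neg h

theorem of_mul_ne_zero {s t : S} : (s : AdjoinZero S) * t ≠ 0 ↔ Comp s t := by
  by_cases h : Comp s t
  · simp [h, of_mul, of_ne_zero]
  · simp [h, of_mul_of_not]

theorem of_mul_eq {s t r : S} : (s : AdjoinZero S) * t = r ↔ ∃ h : Comp s t, mul s t h = r := by
  by_cases h : Comp s t
  · simp [h, of_mul, of_inj]
  · simpa [h, of_mul_of_not] using (of_ne_zero r).symm

end PartialMul

section Semigroupoid

variable {S : Type u} [Semigroupoid S]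

noncomputable instance : Semigroup (AdjoinZero S) where
  mul_assoc a b c := by
    induction a using ind with
    | h₀ => rfl
    | h₁ s =>
    induction b using ind with
    | h₀ => rw [zero_mul, mul_zero, zero_mul]
    | h₁ t =>
    induction c using ind with
    | h₀ => rw [mul_zero, mul_zero, mul_zero]
    | h₁ r =>
    -- The semigroupoid axiom says that the two bracketings are either both defined and equal, or
    -- both undefined and so both zero.
    by_cases h : (Comp s t ∧ Comp t r) ∨ (∃ h : Comp s t, Comp (mul s t h) r) ∨
      (∃ h : Comp t r, Comp s (mul t r h))
    · obtain ⟨hst, htr, h₁, h₂, e⟩ := Semigroupoid.assoc s t r h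
      rw [of_mul hst, of_mul htr, of_mul h₁, of_mul h₂, e]
    · trans 0
      · by_cases hst : Comp s t
        · rw [of_mul hst, of_mul_of_not fun h' => h (.inr (.inl ⟨hst, h'⟩))]
        · rw [of_mul_of_not hst, zero_mul]
      · by_cases htr : Comp t r
        · rw [of_mul htr, of_mul_of_not fun h' => h (.inr (.inr ⟨htr, h'⟩))]
        · rw [of_mul_of_not htr, mul_zero]

/-- The product `abc` is nonzero if `ab` and `bc` are. -/
theorem mul_mul_ne_zero {a b c : AdjoinZero S} (h : a * b ≠ 0) (h' : b * c ≠ 0) :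
    a * b * c ≠ 0 := by
  induction a using ind with
  | h₀ => exact absurd rfl h
  | h₁ s =>
  induction b using ind with
  | h₀ => exact absurd rfl h'
  | h₁ t =>
  induction c using ind with
  | h₀ => exact absurd (mul_zero _) h'
  | h₁ r =>
  obtain ⟨hst, -, h₁, -, -⟩ :=
    Semigroupoid.assoc s t r (.inl ⟨of_mul_ne_zero.1 h, of_mul_ne_zero.1 h'⟩)
  rw [of_mul hst, of_mul h₁]
  exact of_ne_zero _

theorem left_ne_zero {a b : AdjoinZero S} (h : a * b ≠ 0) : a ≠ 0 := by
  rintro rfl; exact h rfl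

theorem right_ne_zero {a b : AdjoinZero S} (h : a * b ≠ 0) : b ≠ 0 := by
  rintro rfl; exact h (mul_zero _)

theorem isPseudoInverse_iff {s t : S} : IsPseudoInverse s t ↔
    (s : AdjoinZero S) * t * s = s ∧ (t : AdjoinZero S) * s * t = t := by
  constructor
  · rintro ⟨h₁, h₂, ⟨h₃, e₃⟩, h₄, e₄⟩
    rw [of_mul h₁, of_mul h₂, of_mul h₃, of_mul h₄, e₃, e₄]
    exact ⟨rfl, rfl⟩
  · rintro ⟨e₁, e₂⟩
    have h₁ : Comp s t := of_mul_ne_zero.1 (left_ne_zero (e₁ ▸ of_ne_zero s))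
    have h₂ : Comp t s := of_mul_ne_zero.1 (left_ne_zero (e₂ ▸ of_ne_zero t))
    rw [of_mul h₁] at e₁
    rw [of_mul h₂] at e₂
    exact ⟨h₁, h₂, of_mul_eq.1 e₁, of_mul_eq.1 e₂⟩

end Semigroupoid

section InverseSemigroupoid

open InverseSemigroupoid

variable {S : Type u} [InverseSemigroupoid S]

noncomputable instance : Inv (AdjoinZero S) :=
  ⟨fun a => match a with
    | some s => of (inv s)
    | none => 0⟩

theorem inv_of (s : S) : (s : AdjoinZero S)⁻¹ = of (inv s) := rfl

/-- Zero is the only inverse of zero, and an inverse of a nonzero element is nonzero, so uniqueness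
is inherited from the semigroupoid. -/
instance : InverseSemigroup (AdjoinZero S) := by
  refine .of_unique ?_ ?_ ?_
  · intro a
    induction a using ind with
    | h₀ => rfl
    | h₁ s => exact (isPseudoInverse_iff.1 (isPseudoInverse_inv s)).1
  · intro a
    induction a using ind with
    | h₀ => rfl
    | h₁ s => exact (isPseudoInverse_iff.1 (isPseudoInverse_inv s)).2
  · intro a b c h₁ h₂ h₃ h₄
    induction a using ind with
    | h₀ => rw [← h₂, ← h₄, mul_zero, mul_zero]; rfl
    | h₁ s =>
    obtain ⟨t, rfl⟩ := exists_of (right_ne_zero (left_ne_zero (h₁ ▸ of_ne_zero s)))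
    obtain ⟨r, rfl⟩ := exists_of (right_ne_zero (left_ne_zero (h₃ ▸ of_ne_zero s)))
    rw [(existsUnique_pseudoInverse s).unique (isPseudoInverse_iff.2 ⟨h₁, h₂⟩)
      (isPseudoInverse_iff.2 ⟨h₃, h₄⟩)]

open InverseSemigroup

theorem of_plus (s : S) : of (plus s) = dom (s : AdjoinZero S) :=
  (of_mul (comp_inv s)).symm

theorem natLE_iff {s t : S} : NatLE s t ↔ Le (s : AdjoinZero S) t := by
  rw [Le, ← of_plus, of_mul_eq]; rfl

theorem isMorphism_iff {S' : Type u} [InverseSemigroupoid S'] {φ : S → S'} : IsMorphism φ ↔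
    ∀ s t r : S, (s : AdjoinZero S) * t = r → (φ s : AdjoinZero S') * φ t = φ r := by
  constructor
  · intro h s t r e
    obtain ⟨hst, rfl⟩ := of_mul_eq.1 e
    obtain ⟨h', e'⟩ := h s t hst
    rw [of_mul h', e']
  · intro h s t hst
    obtain ⟨h', e'⟩ := of_mul_eq.1 (h s t _ (of_mul hst))
    exact ⟨h', e'.symm⟩

theorem isPremorphism_iff {S' : Type u} [InverseSemigroupoid S'] {φ : S → S'} :
    IsPremorphism φ ↔
      (∀ s t r : S, (s : AdjoinZero S) * t = r → (φ s : AdjoinZero S') * φ t ≠ 0 ∧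
        (φ s : AdjoinZero S') * φ t = dom (φ s : AdjoinZero S') * φ r) ∧
      ∀ s : S, Le (dom (φ s : AdjoinZero S')) (φ (plus s)) := by
  constructor
  · rintro ⟨h, h'⟩
    refine ⟨fun s t r e => ?_, fun s => ?_⟩
    · obtain ⟨hst, rfl⟩ := of_mul_eq.1 e
      obtain ⟨h₁, h₂, e⟩ := h s t hst
      rw [of_mul h₁, ← of_plus, of_mul h₂, e]
      exact ⟨of_ne_zero _, rfl⟩
    · rw [← of_plus, ← natLE_iff]; exact h' s
  · rintro ⟨h, h'⟩
    refine ⟨fun s t hst => ?_, fun s => ?_⟩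
    · obtain ⟨h₀, e⟩ := h s t _ (of_mul hst)
      have h₁ := of_mul_ne_zero.1 h₀
      rw [e, ← of_plus] at h₀
      have h₂ := of_mul_ne_zero.1 h₀
      rw [of_mul h₁, ← of_plus, of_mul h₂, of_inj] at e
      exact ⟨h₁, h₂, e⟩
    · rw [natLE_iff, of_plus]; exact h' s

end InverseSemigroupoid

end AdjoinZero

/-! ### The li-constellation of an inverse semigroupoid -/

/-- The underlying set of an inverse semigroupoid, regarded as a left constellation. -/
def Const (S : Type u) : Type u := S

namespace Const

open InverseSemigroup

variable {S : Type u}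

/-- The inclusion into the inverse semigroup obtained by adjoining a zero. -/
def val (x : Const S) : AdjoinZero S := AdjoinZero.of (S := S) x

theorem val_ne_zero (x : Const S) : val x ≠ 0 := AdjoinZero.of_ne_zero _

theorem val_inj {x y : Const S} : val x = val y ↔ x = y := AdjoinZero.of_inj

theorem exists_val {a : AdjoinZero S} (h : a ≠ 0) : ∃ x : Const S, val x = a :=
  AdjoinZero.exists_of h

variable [InverseSemigroupoid S]

/-- Both `xy⁺ = x` and `y⁺y = y` are nonzero, hence so is `xy⁺y = xy`. The constellation thus keeps
only some of the products of the semigroupoid. -/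
theorem comp_of_val {x y : Const S} (h : val x * dom (val y) = val x) :
    Comp (S := S) x y := by
  have h₁ : val x * dom (val y) ≠ 0 := by rw [h]; exact val_ne_zero x
  have h₂ : dom (val y) * val y ≠ 0 := (dom_mul_self (val y)).symm ▸ val_ne_zero y
  have := AdjoinZero.mul_mul_ne_zero h₁ h₂
  rw [mul_dom_mul] at this
  exact AdjoinZero.of_mul_ne_zero.1 this

noncomputable instance : PartialMul (Const S) where
  Comp x y := val x * dom (val y) = val x
  mul x y h := mul (S := S) x y (comp_of_val h)

theorem comp_iff {x y : Const S} : Comp x y ↔ val x * dom (val y) = val x := Iff.rfl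

theorem val_mul {x y : Const S} (h : Comp x y) : val (mul x y h) = val x * val y :=
  (AdjoinZero.of_mul (comp_of_val h)).symm

theorem mul_eq_iff {x y z : Const S} : (∃ h : Comp x y, mul x y h = z) ↔
    val x * dom (val y) = val x ∧ val x * val y = val z := by
  constructor
  · rintro ⟨h, rfl⟩; exact ⟨h, (val_mul h).symm⟩
  · rintro ⟨h, e⟩; exact ⟨h, val_inj.1 (by rw [val_mul h, e])⟩

/-- The operation `x⁺`. -/
noncomputable def plus (x : Const S) : Const S := InverseSemigroupoid.plus (S := S) x

theorem val_plus (x : Const S) : val (plus x) = dom (val x) := AdjoinZero.of_plus _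

theorem exists_plus_iff {e : Const S} :
    e ∈ Set.range (plus : Const S → Const S) ↔ val e * val e = val e := by
  constructor
  · rintro ⟨x, rfl⟩; rw [val_plus, dom_idem]
  · intro h; exact ⟨e, val_inj.1 (by rw [val_plus, dom_of_idem h])⟩

theorem dom_mul_of_comp {x y : Const S} (h : Comp x y) : dom (val x * val y) = dom (val x) := by
  rw [← dom_mul_dom, h]

noncomputable instance : LeftConstellation (Const S) where
  plus := plus
  comp_iff x y z := by
    constructor
    · rintro ⟨h, h'⟩
      refine ⟨h', ?_⟩
      rw [comp_iff, val_mul, dom_mul_of_comp h', h]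
    · rintro ⟨h', h⟩
      rw [comp_iff, val_mul, dom_mul_of_comp h'] at h
      exact ⟨h, h'⟩
  assoc x y z hxy hyz := by
    refine ⟨?_, ?_, ?_⟩
    · rw [comp_iff, val_mul, mul_assoc, hyz]
    · rw [comp_iff, val_mul, dom_mul_of_comp hyz, hxy]
    · rw [← val_inj, val_mul, val_mul, val_mul, val_mul, mul_assoc]
  left_unit_iff e he x := by
    rw [exists_plus_iff] at he
    rw [mul_eq_iff, ← val_inj, val_plus]
    constructor
    · rintro ⟨h, h'⟩
      rw [← h, ← dom_idem_mul he, h']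
    · intro h
      rw [h, dom_idem, dom_mul_self]; exact ⟨rfl, rfl⟩
  right_unit e he x h := by
    rw [exists_plus_iff] at he
    rw [← val_inj, val_mul]
    rw [comp_iff, dom_of_idem he] at h
    exact h

noncomputable instance : PartialOrder (Const S) where
  le x y := InverseSemigroupoid.NatLE (S := S) x y
  le_refl x := AdjoinZero.natLE_iff.2 (Le.refl _)
  le_trans x y z h h' :=
    AdjoinZero.natLE_iff.2 (Le.trans (AdjoinZero.natLE_iff.1 h) (AdjoinZero.natLE_iff.1 h'))
  le_antisymm x y h h' := (AdjoinZero.of_inj (S := S)).1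
    (Le.antisymm (AdjoinZero.natLE_iff.1 h) (AdjoinZero.natLE_iff.1 h'))

theorem le_iff {x y : Const S} : x ≤ y ↔ Le (val x) (val y) := AdjoinZero.natLE_iff

theorem val_plus' (x : Const S) : val (LeftConstellation.plus x) = dom (val x) := val_plus x

theorem mem_Plus {e : Const S} : e ∈ Plus (Const S) ↔ val e * val e = val e := exists_plus_iff

theorem comp_iff_of_idem {x e : Const S} (he : val e * val e = val e) :
    Comp x e ↔ val x * val e = val x := by
  rw [comp_iff, dom_of_idem he]

/-- If `y ≤ x` and `ye = y`, then `y = ye ≤ xe`, so a nonzero `xe` is the maximum. Moreover such a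
`y` equals `y⁺(xe)`, which forces `xe ≠ 0`. -/
theorem isCorestriction_iff {x e z : Const S} (he : val e * val e = val e) :
    IsCorestriction x e z ↔ val x * val e = val z := by
  have key : ∀ z : Const S, val x * val e = val z → IsCorestriction x e z := by
    intro z hz
    refine ⟨⟨?_, ?_⟩, ?_⟩
    · rw [le_iff, ← hz]; exact le_of_mul_idem he _
    · rw [comp_iff_of_idem he, ← hz, mul_assoc, he]
    · rintro y ⟨hy, hy'⟩
      rw [comp_iff_of_idem he] at hy'
      rw [le_iff] at hy ⊢
      rw [← hz, ← hy']
      exact hy.mul (Le.refl _)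
  refine ⟨fun h => ?_, key z⟩
  have h₀ : val x * val e ≠ 0 := by
    obtain ⟨h₁, h₂⟩ := h.1
    rw [le_iff] at h₁
    rw [comp_iff_of_idem he] at h₂
    have : val z = dom (val z) * (val x * val e) := by
      rw [← mul_assoc, h₁, h₂]
    exact AdjoinZero.right_ne_zero (this ▸ val_ne_zero z)
  obtain ⟨z', hz'⟩ := exists_val h₀
  rw [← hz', val_inj]
  exact (key z' hz'.symm).unique h

theorem hasCorestriction_iff {x e : Const S} (he : val e * val e = val e) :
    HasCorestriction x e ↔ val x * val e ≠ 0 := by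
  constructor
  · rintro ⟨z, h⟩
    rw [(isCorestriction_iff he).1 h]; exact val_ne_zero z
  · intro h
    obtain ⟨z, hz⟩ := exists_val h
    exact ⟨z, (isCorestriction_iff he).2 hz.symm⟩

theorem isRestriction_iff {x e z : Const S} (he : e ≤ LeftConstellation.plus x) :
    IsRestriction e x z ↔ val e * val x = val z := by
  have hid : val e * val e = val e := by
    rw [le_iff, val_plus'] at he
    exact he.of_idem (dom_idem _)
  rw [le_iff, val_plus', le_iff_of_idem hid] at he
  rw [IsRestriction, le_iff, ← val_inj, val_plus']
  constructor
  · rintro ⟨h, h'⟩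
    rw [← h', h]
  · intro h
    rw [← h]
    refine ⟨le_of_idem_mul hid _, ?_⟩
    rw [dom_idem_mul hid, he]

/-- Since `(xy⁺)y = xy`, the pseudo-product recovers the full semigroupoid product from the
constellation. -/
theorem isPseudoProduct_iff {x y z : Const S} :
    IsPseudoProduct x y z ↔ val x * val y = val z := by
  have hid := dom_idem (val y)
  rw [← val_plus'] at hid
  constructor
  · rintro ⟨a, h, h', rfl⟩
    rw [isCorestriction_iff hid, val_plus'] at h
    rw [val_mul, ← h, mul_dom_mul]
  · intro h
    have h₀ : val x * dom (val y) ≠ 0 := by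
      rw [← mul_dom_mul] at h
      exact AdjoinZero.left_ne_zero (h ▸ val_ne_zero z)
    obtain ⟨a, ha⟩ := exists_val h₀
    refine ⟨a, (isCorestriction_iff hid).2 (by rw [val_plus', ha]), mul_eq_iff.2 ⟨?_, ?_⟩⟩
    · rw [ha, mul_assoc, dom_idem]
    · rw [ha, mul_dom_mul, h]

theorem connected_iff {e f : Plus (Const S)} :
    Connected e f ↔ val (e : Const S) * val (f : Const S) ≠ 0 := by
  have idem : ∀ e : Plus (Const S), val (e : Const S) * val (e : Const S) = val (e : Const S) :=
    fun e => mem_Plus.1 e.2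
  have comm : ∀ e f : Plus (Const S),
      val (e : Const S) * val (f : Const S) = val (f : Const S) * val (e : Const S) :=
    fun e f => idem_comm _ _ (idem e) (idem f)
  constructor
  · intro h
    induction h with
    | rel e f h =>
      rw [← Subtype.coe_le_coe, le_iff, le_iff_of_idem (idem e)] at h
      rw [h]; exact val_ne_zero _
    | refl e => rw [idem]; exact val_ne_zero _
    | symm e f _ ih => rwa [comm]
    | trans e f g _ _ ih₁ ih₂ =>
      -- From `ef ≠ 0` and `fg ≠ 0` follows `efg = f(eg) ≠ 0`, so `eg ≠ 0`.
      have := AdjoinZero.mul_mul_ne_zero ih₁ ih₂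
      rw [comm e f, mul_assoc] at this
      exact AdjoinZero.right_ne_zero this
  · intro h
    obtain ⟨w, hw⟩ := exists_val h
    have hw' : val w * val w = val w := by
      have := comm e f
      have := idem e
      have := idem f
      grind
    have h₁ : (⟨w, mem_Plus.2 hw'⟩ : Plus (Const S)) ≤ e := by
      rw [← Subtype.coe_le_coe, le_iff, hw]; exact le_of_mul_idem (idem f) _
    have h₂ : (⟨w, mem_Plus.2 hw'⟩ : Plus (Const S)) ≤ f := by
      rw [← Subtype.coe_le_coe, le_iff, hw]; exact le_of_idem_mul (idem e) _
    exact .trans _ _ _ (.symm _ _ (.rel _ _ h₁)) (.rel _ _ h₂)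

theorem exists_meet {e f : Plus (Const S)} (h : val (e : Const S) * val (f : Const S) ≠ 0) :
    ∃ w : Plus (Const S), val (w : Const S) = val (e : Const S) * val (f : Const S) ∧
      w ≤ e ∧ w ≤ f ∧ ∀ g : Plus (Const S), g ≤ e → g ≤ f → g ≤ w := by
  have he := mem_Plus.1 e.2
  have hf := mem_Plus.1 f.2
  have hef := idem_comm _ _ he hf
  obtain ⟨w, hw⟩ := exists_val h
  have hw' : val w * val w = val w := by grind
  refine ⟨⟨w, mem_Plus.2 hw'⟩, hw, ?_, ?_, ?_⟩
  · rw [← Subtype.coe_le_coe, le_iff, hw]; exact le_of_mul_idem hf _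
  · rw [← Subtype.coe_le_coe, le_iff, hw]; exact le_of_idem_mul he _
  · intro g h₁ h₂
    have hg := mem_Plus.1 g.2
    rw [← Subtype.coe_le_coe, le_iff, le_iff_of_idem hg] at h₁ h₂ ⊢
    rw [hw, ← mul_assoc, h₁, h₂]

/-! ### The li-constellation axioms and right inverses -/

variable (S)

theorem isLocallyInductive : IsLocallyInductive (Const S) where
  mul_le_mul x y x' y' h h' h₁ h₂ := by
    rw [le_iff] at *
    rw [val_mul, val_mul]
    exact h₁.mul h₂
  plus_le_plus x y h := by
    rw [le_iff] at *
    rw [val_plus', val_plus']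
    exact h.dom_le
  restriction e he x h := by
    have h' := le_iff.1 h
    rw [mem_Plus] at he
    rw [le_iff_of_idem he, val_plus', ← dom_idem_mul he] at h'
    obtain ⟨z, hz⟩ := exists_val (AdjoinZero.left_ne_zero (a := val e * val x)
      (b := (val e * val x)⁻¹) (by rw [← dom, h']; exact val_ne_zero e))
    refine ⟨z, (isRestriction_iff h).2 hz.symm, fun y hy => ?_⟩
    rw [← val_inj, hz, (isRestriction_iff h).1 hy]
  corestriction e he x := by
    rw [mem_Plus] at he
    rw [hasCorestriction_iff he, or_iff_not_imp_left, ← Ne, ← Set.nonempty_iff_ne_empty]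
    rintro ⟨y, h₁, h₂⟩
    rw [le_iff] at h₁
    rw [comp_iff_of_idem he] at h₂
    have : val y = dom (val y) * (val x * val e) := by rw [← mul_assoc, h₁, h₂]
    exact AdjoinZero.right_ne_zero (this ▸ val_ne_zero y)
  corestriction_mul e he x y h := by
    rw [mem_Plus] at he
    rw [hasCorestriction_iff he, hasCorestriction_iff he, val_mul, mul_assoc]
    refine ⟨AdjoinZero.right_ne_zero, fun h' => ?_⟩
    rw [← mul_assoc]
    exact AdjoinZero.mul_mul_ne_zero (by rw [← val_mul h]; exact val_ne_zero _) h'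
  corestriction_le e he f hf hfe x := by
    rw [mem_Plus] at he hf
    rw [le_iff, le_iff_of_idem hf] at hfe
    have hfe' : val e * val f = val f := by rw [idem_comm _ _ he hf, hfe]
    rw [hasCorestriction_iff he, hasCorestriction_iff hf]
    constructor
    · intro h
      have := AdjoinZero.mul_mul_ne_zero h (hfe' ▸ val_ne_zero f)
      rwa [mul_assoc, hfe'] at this
    · intro h
      rw [← hfe', ← mul_assoc] at h
      exact AdjoinZero.left_ne_zero h
  plus_corestriction_mul e he x y h z hz := by
    rw [mem_Plus] at he
    rw [isCorestriction_iff he, val_mul, mul_assoc] at hz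
    have hz₀ : val x * (val y * val e) ≠ 0 := hz ▸ val_ne_zero z
    obtain ⟨w, hw⟩ := exists_val (AdjoinZero.right_ne_zero hz₀)
    rw [← hw] at hz hz₀
    rw [← mul_dom_mul] at hz₀
    obtain ⟨v, hv⟩ := exists_val (AdjoinZero.left_ne_zero hz₀)
    have hid := dom_idem (val w)
    rw [← val_plus'] at hid
    -- Here `w = ye` and `v = xw⁺`, so the axiom reads `(x(ye))⁺ = (x(ye)⁺)⁺`.
    refine ⟨w, v, (isCorestriction_iff he).2 hw.symm, (isCorestriction_iff hid).2 ?_, ?_⟩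
    · rw [val_plus', hv]
    · rw [← val_inj, val_plus', val_plus', hv, dom_mul_dom, hz]
  restriction_eq_corestriction e he f hf h z := by
    have hfp : LeftConstellation.plus f = f := by
      rw [← val_inj, val_plus', dom_of_idem (mem_Plus.1 hf)]
    rw [isCorestriction_iff (mem_Plus.1 hf), isRestriction_iff (hfp.symm ▸ h)]
  localMeetSemilattice := by
    rintro x ⟨y, hy⟩ ⟨z, hz⟩
    have hyz : Connected y z := .trans _ _ _ hy (.symm _ _ hz)
    obtain ⟨w, -, h₁, h₂, h₃⟩ := exists_meet (connected_iff.1 hyz)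
    refine ⟨⟨w, .trans _ _ _ (.rel _ _ h₁) hy⟩, ?_, ?_⟩
    · rintro _ (rfl | rfl)
      exacts [h₁, h₂]
    · intro g hg
      exact h₃ g (hg (.inl rfl)) (hg (.inr rfl))
  corestriction_iff_meet e f z := by
    rw [isCorestriction_iff (mem_Plus.1 f.2), connected_iff]
    have key : ∀ w : Plus (Const S), (w ≤ e ∧ w ≤ f ∧ ∀ g : Plus (Const S), g ≤ e → g ≤ f →
        g ≤ w) → IsGLB {e, f} w := by
      rintro w ⟨h₁, h₂, h₃⟩
      refine ⟨?_, fun g hg => h₃ g (hg (.inl rfl)) (hg (.inr rfl))⟩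
      rintro _ (rfl | rfl)
      exacts [h₁, h₂]
    constructor
    · intro h
      have h₀ := h ▸ val_ne_zero z
      obtain ⟨w, hw, hw'⟩ := exists_meet h₀
      exact ⟨h₀, w, val_inj.1 (hw.trans h), key w hw'⟩
    · rintro ⟨h₀, w, rfl, hw⟩
      obtain ⟨w', hw₁, hw₂⟩ := exists_meet h₀
      rw [← hw₁, (key w' hw₂).unique hw]

theorem hasRightInverses : HasRightInverses (Const S) := by
  intro x
  have h := mul_inv_mul (val x)
  have h₀ : val x * (val x)⁻¹ ≠ 0 := AdjoinZero.left_ne_zero (h ▸ val_ne_zero x)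
  obtain ⟨y, hy⟩ := exists_val (AdjoinZero.right_ne_zero h₀)
  refine ⟨y, mul_eq_iff.2 ⟨?_, ?_⟩⟩
  · rw [hy, dom, ← eq_inv (inv_mul_inv (val x)) (mul_inv_mul (val x)), ← mul_assoc, h]
  · rw [hy, val_plus', dom]

end Const

/-- The product `xy` is defined and equal to `z`. -/
def IsMul {X : Type u} [PartialMul X] (x y z : X) : Prop := ∃ h : Comp x y, mul x y h = z

theorem IsMul.unique {X : Type u} [PartialMul X] {x y z z' : X} (h : IsMul x y z)
    (h' : IsMul x y z') : z = z' := by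
  obtain ⟨_, rfl⟩ := h
  obtain ⟨_, rfl⟩ := h'
  rfl

/-! ### Left constellations -/

namespace LeftConstellation

section

variable {T : Type u} [LeftConstellation T]

theorem plus_mul_self (x : T) : IsMul (plus x) x x :=
  (left_unit_iff (plus x) ⟨x, rfl⟩ x).2 rfl

/-- For `e = x⁺` the product `e(ex)` is defined, so `ee` is too; it equals `e` by the right unit
law, and left units are unique. -/
theorem plus_plus (x : T) : plus (plus x) = plus x := by
  obtain ⟨h, e⟩ := plus_mul_self x
  have h' : Comp (plus x) (plus x) := ((comp_iff (plus x) (plus x) x).2 ⟨h, by rwa [e]⟩).1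
  exact ((left_unit_iff _ ⟨x, rfl⟩ (plus x)).1 ⟨h', right_unit _ ⟨x, rfl⟩ _ h'⟩).symm

theorem plus_of_mem {e : T} (he : e ∈ Plus T) : plus e = e := by
  obtain ⟨x, rfl⟩ := he
  exact plus_plus x

theorem comp_plus_iff {x y : T} : Comp x (plus y) ↔ Comp x y := by
  obtain ⟨h, e⟩ := plus_mul_self y
  have := comp_iff x (plus y) y
  simp only [h, and_true, exists_true_left, e] at this
  exact this

theorem _root_.ESN.IsMul.assoc {x y z a b : T} (h : IsMul x y a) (h' : IsMul y z b) :
    ∃ c, IsMul a z c ∧ IsMul x b c := by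
  obtain ⟨h, rfl⟩ := h
  obtain ⟨h', rfl⟩ := h'
  obtain ⟨h₁, h₂, e⟩ := LeftConstellation.assoc x y z h h'
  exact ⟨_, ⟨h₁, rfl⟩, h₂, e⟩

theorem _root_.ESN.IsMul.plus_eq {x y z : T} (h : IsMul x y z) : plus z = plus x := by
  obtain ⟨c, h₁, h₂⟩ := IsMul.assoc (plus_mul_self x) h
  obtain rfl := h.unique h₁
  exact ((left_unit_iff _ ⟨x, rfl⟩ _).1 h₂).symm

theorem isMul_idem {x e : T} (he : e ∈ Plus T) (h : Comp x e) : IsMul x e x :=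
  ⟨h, right_unit e he x h⟩

end

end LeftConstellation

open LeftConstellation

/-! ### Locally inductive left constellations -/

namespace IsLocallyInductive

variable {T : Type u} [LeftConstellation T] [PartialOrder T]

/-- Uniqueness of restrictions; this is the standard way below to turn an inequality between
elements with the same `⁺` into an equality. -/
theorem eq_of_plus_eq (hT : IsLocallyInductive T) {a b c : T} (ha : a ≤ c) (hb : b ≤ c)
    (h : plus a = plus b) : a = b :=
  (hT.restriction (plus a) ⟨a, rfl⟩ c (hT.plus_le_plus _ _ ha)).unique ⟨ha, rfl⟩ ⟨hb, h.symm⟩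

theorem isMul_mono (hT : IsLocallyInductive T) {x y z x' y' z' : T} (h : IsMul x y z)
    (h' : IsMul x' y' z') (hx : x ≤ x') (hy : y ≤ y') : z ≤ z' := by
  obtain ⟨h, rfl⟩ := h
  obtain ⟨h', rfl⟩ := h'
  exact hT.mul_le_mul _ _ _ _ h h' hx hy

theorem _root_.ESN.isCorestriction_self {x e : T} (h : Comp x e) : IsCorestriction x e x :=
  ⟨⟨le_rfl, h⟩, fun _ hy => hy.1⟩

theorem comp_of_le (hT : IsLocallyInductive T) {e f : T} (he : e ∈ Plus T) (hf : f ∈ Plus T)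
    (h : e ≤ f) : Comp e f :=
  ((hT.restriction_eq_corestriction e he f hf h e).1 ⟨h, plus_of_mem he⟩).1.2

theorem le_of_comp (hT : IsLocallyInductive T) {e f : T} (he : e ∈ Plus T) (hf : f ∈ Plus T)
    (h : Comp e f) : e ≤ f := by
  obtain ⟨-, w, hw, hw'⟩ :=
    (hT.corestriction_iff_meet ⟨e, he⟩ ⟨f, hf⟩ e).1 (isCorestriction_self h)
  have := hw'.1 (.inr rfl)
  rwa [← Subtype.coe_le_coe, hw] at this

theorem comp_mono (hT : IsLocallyInductive T) {x e f : T} (he : e ∈ Plus T) (hf : f ∈ Plus T)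
    (h : e ≤ f) (hx : Comp x e) : Comp x f := by
  obtain ⟨c, ⟨h', -⟩, -⟩ :=
    IsMul.assoc (isMul_idem he hx) (isMul_idem hf (hT.comp_of_le he hf h))
  exact h'

theorem isCorestriction_comm (hT : IsLocallyInductive T) {e f z : T} (he : e ∈ Plus T)
    (hf : f ∈ Plus T) (h : IsCorestriction e f z) : IsCorestriction f e z := by
  obtain ⟨hc, w, hw, hw'⟩ := (hT.corestriction_iff_meet ⟨e, he⟩ ⟨f, hf⟩ z).1 h
  exact (hT.corestriction_iff_meet ⟨f, hf⟩ ⟨e, he⟩ z).2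
    ⟨.symm _ _ hc, w, hw, Set.pair_comm _ _ ▸ hw'⟩

theorem _root_.ESN.IsMul.isPseudoProduct {x y z : T} (h : IsMul x y z) :
    IsPseudoProduct x y z :=
  ⟨x, isCorestriction_self (comp_plus_iff.2 h.1), h⟩

theorem _root_.ESN.IsPseudoProduct.unique {x y z z' : T} (h : IsPseudoProduct x y z)
    (h' : IsPseudoProduct x y z') : z = z' := by
  obtain ⟨a, ha, hz⟩ := h
  obtain ⟨a', ha', hz'⟩ := h'
  obtain rfl := IsGreatest.unique ha ha'
  exact IsMul.unique hz hz'

theorem _root_.ESN.hasCorestriction_iff_exists_isPseudoProduct {x y : T} :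
    HasCorestriction x (plus y) ↔ ∃ z, IsPseudoProduct x y z :=
  ⟨fun ⟨a, ha⟩ => ⟨_, a, ha, comp_plus_iff.1 ha.1.2, rfl⟩, fun ⟨_, a, ha, _⟩ => ⟨a, ha⟩⟩

theorem _root_.ESN.isPseudoProduct_idem {x e z : T} (he : e ∈ Plus T) :
    IsPseudoProduct x e z ↔ IsCorestriction x e z := by
  rw [IsPseudoProduct, plus_of_mem he]
  constructor
  · rintro ⟨a, ha, h⟩
    rwa [IsMul.unique h (isMul_idem he ha.1.2)]
  · intro h
    exact ⟨z, h, isMul_idem he h.1.2⟩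

/-- With `a = s|t⁺`, `c = t|r⁺` and `d = s|c⁺`, both bracketings are the triple constellation
product `dcr`. The point is that `(at)|r⁺ = dc`: the axiom on `((xy)|e)⁺` gives both sides the same
`⁺`, and both lie below `at`. -/
theorem isPseudoProduct_assoc (hT : IsLocallyInductive T) {s t r : T}
    (hst : HasCorestriction s (plus t)) (htr : HasCorestriction t (plus r)) :
    ∃ p q v, IsPseudoProduct s t p ∧ IsPseudoProduct t r q ∧
      IsPseudoProduct p r v ∧ IsPseudoProduct s q v := by
  obtain ⟨a, ha⟩ := hst
  obtain ⟨c, hc⟩ := htr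
  obtain ⟨p, hp⟩ : ∃ p, IsMul a t p := ⟨_, comp_plus_iff.1 ha.1.2, rfl⟩
  obtain ⟨q, hq⟩ : ∃ q, IsMul c r q := ⟨_, comp_plus_iff.1 hc.1.2, rfl⟩
  have hct := hT.plus_le_plus _ _ hc.1.1
  obtain ⟨d, hd⟩ := (hT.corestriction_le _ ⟨t, rfl⟩ _ ⟨c, rfl⟩ hct s).1 ⟨a, ha⟩
  obtain ⟨m, hm⟩ : ∃ m, IsMul d c m := ⟨_, comp_plus_iff.1 hd.1.2, rfl⟩
  obtain ⟨v, hv, hv'⟩ := IsMul.assoc hm hq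
  refine ⟨p, q, v, ⟨a, ha, hp⟩, ⟨c, hc, hq⟩, ⟨m, ?_, hv⟩, ⟨d, ?_, hv'⟩⟩
  · obtain ⟨hat, e⟩ := hp
    obtain ⟨b, hb⟩ := (hT.corestriction_mul (plus r) ⟨r, rfl⟩ a t hat).2 ⟨c, hc⟩
    obtain ⟨c', v', hc', hd', hbv⟩ := hT.plus_corestriction_mul (plus r) ⟨r, rfl⟩ a t hat b hb
    obtain rfl := IsGreatest.unique hc' hc
    rw [e] at hb
    -- Corestricting first to `t⁺` and then to the smaller `c⁺` is the same as corestricting to `c⁺`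
    -- at once.
    obtain rfl : v' = d := by
      refine le_antisymm (hd.2 ⟨hd'.1.1.trans ha.1.1, hd'.1.2⟩) (hd'.2 ⟨ha.2 ⟨hd.1.1, ?_⟩, hd.1.2⟩)
      exact hT.comp_mono ⟨c', rfl⟩ ⟨t, rfl⟩ hct hd.1.2
    rwa [hT.eq_of_plus_eq (hT.isMul_mono hm ⟨hat, e⟩ hd'.1.1 hc.1.1) hb.1.1
      (hm.plus_eq.trans hbv.symm)]
  · rwa [hq.plus_eq]

/-- The corestriction `e|e⁺` lies below `e` with the same `⁺`, so it is `e` and `ee = e`. For a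
right inverse `a`, `e⁺ = ea = (ee)a = e(ea) = ee⁺ = e`. -/
theorem mem_Plus_of_isPseudoProduct_self (hT : IsLocallyInductive T) (hR : HasRightInverses T)
    {e : T} (h : IsPseudoProduct e e e) : e ∈ Plus T := by
  obtain ⟨b, hb, h⟩ := h
  obtain rfl : b = e := hT.eq_of_plus_eq hb.1.1 le_rfl (IsMul.plus_eq h).symm
  obtain ⟨a, ha⟩ := hR b
  obtain ⟨c, h₁, h₂⟩ := IsMul.assoc h ha
  obtain rfl := IsMul.unique ha h₁
  exact ⟨b, (h₂.unique (isMul_idem ⟨b, rfl⟩ h₂.1))⟩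

/-- A right inverse `y` is replaced by `a = y|x⁺`, for which `ax` is defined. The axiom on
`((xy)|e)⁺` shows `x|a⁺ = x`, so `xa` is still defined; it lies below `xy = x⁺` and has the same
`⁺`. -/
theorem exists_right_inverse (hT : IsLocallyInductive T) (hR : HasRightInverses T) (x : T) :
    ∃ a, IsMul x a (plus x) ∧ Comp a x := by
  obtain ⟨y, hy⟩ := hR x
  obtain ⟨hxy, e⟩ := id hy
  have hx : IsCorestriction (plus x) (plus x) (plus x) :=
    isCorestriction_self (comp_plus_iff.2 (plus_mul_self x).1)
  rw [← e] at hx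
  nth_rewrite 2 [e] at hx
  obtain ⟨a, v, ha, hv, h⟩ := hT.plus_corestriction_mul (plus x) ⟨x, rfl⟩ x y hxy _ hx
  obtain rfl : x = v := by
    refine hT.eq_of_plus_eq le_rfl hv.1.1 ?_
    rw [← h, e, plus_plus]
  obtain ⟨c, hc⟩ : ∃ c, IsMul x a c := ⟨_, comp_plus_iff.1 hv.1.2, rfl⟩
  refine ⟨a, ?_, comp_plus_iff.1 ha.1.2⟩
  rwa [← hT.eq_of_plus_eq (hT.isMul_mono hc hy le_rfl ha.1.1) le_rfl
    (by rw [hc.plus_eq, plus_plus])]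

/-- Let `b` be a right inverse of `a`. Then `x = x(ab) = (xa)b = x⁺b ≤ b`, so `ax ≤ ab = a⁺`; both
sides have `⁺` equal to `a⁺`, hence agree. -/
theorem exists_inverse (hT : IsLocallyInductive T) (hR : HasRightInverses T) (x : T) :
    ∃ a, IsMul x a (plus x) ∧ IsMul a x (plus a) := by
  obtain ⟨a, hxa, hax⟩ := hT.exists_right_inverse hR x
  obtain ⟨b, hab, -⟩ := hT.exists_right_inverse hR a
  obtain ⟨c, h₁, h₂⟩ := IsMul.assoc hxa hab
  obtain rfl := h₂.unique (isMul_idem ⟨a, rfl⟩ h₂.1)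
  have hcb : plus c ≤ plus b :=
    hT.le_of_comp ⟨c, rfl⟩ ⟨b, rfl⟩ (comp_plus_iff.2 h₁.1)
  have hle : c ≤ b := hT.isMul_mono h₁ (plus_mul_self b) hcb le_rfl
  obtain ⟨d, hd⟩ : ∃ d, IsMul a c d := ⟨_, hax, rfl⟩
  refine ⟨a, hxa, ?_⟩
  rwa [← hT.eq_of_plus_eq (hT.isMul_mono hd hab le_rfl hle) le_rfl
    (by rw [hd.plus_eq, plus_plus])]

end IsLocallyInductive

/-! ### The inverse semigroupoid of an li-constellation -/

/-- The underlying set of an li-constellation, with the pseudo-product. -/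
def Pseudo (X : LIConstRightInv.{u}) : Type u := X.carrier

namespace Pseudo

variable {X : LIConstRightInv.{u}}

/-- An element of an li-constellation as an element of its semigroupoid. -/
def mk (x : X.carrier) : Pseudo X := x

noncomputable instance : PartialMul (Pseudo X) where
  Comp s t := HasCorestriction (T := X.carrier) s (plus (T := X.carrier) t)
  mul _ _ h := (hasCorestriction_iff_exists_isPseudoProduct.1 h).choose

theorem isMul_iff {s t r : X.carrier} :
    IsMul (mk s) (mk t) (mk r) ↔ IsPseudoProduct s t r := by
  constructor
  · rintro ⟨h, e⟩
    obtain rfl : _ = r := e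
    exact (hasCorestriction_iff_exists_isPseudoProduct.1 h).choose_spec
  · intro h
    have h' := hasCorestriction_iff_exists_isPseudoProduct.2 ⟨r, h⟩
    exact ⟨h', (hasCorestriction_iff_exists_isPseudoProduct.1 h').choose_spec.unique h⟩

noncomputable instance : Semigroupoid (Pseudo X) where
  assoc s t r h := by
    have key : HasCorestriction (T := X.carrier) s (plus (T := X.carrier) t) ∧
        HasCorestriction (T := X.carrier) t (plus (T := X.carrier) r) := by
      -- All three alternatives reduce to the first: `corestriction_mul` drops the left factor of
      -- `st`, and `corestriction_le` enlarges `(t|r⁺)⁺` to `t⁺`.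
      rcases h with h | ⟨h, h'⟩ | ⟨h, h'⟩
      · exact h
      · refine ⟨h, ?_⟩
        obtain ⟨a, ha, hat, e⟩ := isMul_iff.1 ⟨h, rfl⟩
        have h' : HasCorestriction (T := X.carrier) (mul a t hat) (plus (T := X.carrier) r) :=
          e ▸ h'
        exact (X.locallyInductive.corestriction_mul _ ⟨_, rfl⟩ _ _ _).1 h'
      · refine ⟨?_, h⟩
        obtain ⟨a, ha, hat⟩ := isMul_iff.1 ⟨h, rfl⟩
        have h' : HasCorestriction (T := X.carrier) s (plus (T := X.carrier) a) :=
          IsMul.plus_eq hat ▸ h'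
        exact (X.locallyInductive.corestriction_le _ ⟨_, rfl⟩ _ ⟨_, rfl⟩
          (X.locallyInductive.plus_le_plus _ _ ha.1.1) _).2 h'
    obtain ⟨p, q, v, h₁, h₂, h₃, h₄⟩ := X.locallyInductive.isPseudoProduct_assoc key.1 key.2
    obtain ⟨c₁, rfl⟩ := isMul_iff.2 h₁
    obtain ⟨c₂, rfl⟩ := isMul_iff.2 h₂
    obtain ⟨c₃, e₃⟩ := isMul_iff.2 h₃
    obtain ⟨c₄, e₄⟩ := isMul_iff.2 h₄
    exact ⟨c₁, c₂, c₃, c₄, e₃.trans e₄.symm⟩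

/-- The inclusion into the semigroup obtained by adjoining a zero. -/
def val (x : X.carrier) : AdjoinZero (Pseudo X) := AdjoinZero.of (mk x)

theorem mul_eq_iff {s t r : X.carrier} :
    val s * val t = val r ↔ IsPseudoProduct s t r := by
  rw [← isMul_iff]; exact AdjoinZero.of_mul_eq

theorem isMul_mul {s t r : X.carrier} (h : IsMul s t r) : val s * val t = val r :=
  mul_eq_iff.2 h.isPseudoProduct

theorem mem_Plus {e : X.carrier} (h : val e * val e = val e) : e ∈ Plus X.carrier :=
  X.locallyInductive.mem_Plus_of_isPseudoProduct_self X.hasRightInverses (mul_eq_iff.1 h)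

/-- Nonzero idempotents lie in `T⁺`, where the product is a corestriction, that is, a meet, and
therefore symmetric. -/
theorem idem_comm {a b : AdjoinZero (Pseudo X)} (ha : a * a = a) (hb : b * b = b) :
    a * b = b * a := by
  induction a using AdjoinZero.ind with
  | h₀ => rw [AdjoinZero.mul_zero, AdjoinZero.zero_mul]
  | h₁ e =>
  induction b using AdjoinZero.ind with
  | h₀ => rw [AdjoinZero.mul_zero, AdjoinZero.zero_mul]
  | h₁ f =>
  have he := mem_Plus ha
  have hf := mem_Plus hb
  by_cases h₀ : (AdjoinZero.of e * AdjoinZero.of f : AdjoinZero (Pseudo X)) = 0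
  · by_contra h₁
    rw [h₀] at h₁
    obtain ⟨z, hz⟩ := AdjoinZero.exists_of (Ne.symm h₁)
    have h₂ := (isPseudoProduct_idem he).1 (mul_eq_iff.1 hz.symm)
    have h₃ := mul_eq_iff.2
      ((isPseudoProduct_idem hf).2 (X.locallyInductive.isCorestriction_comm hf he h₂))
    exact AdjoinZero.of_ne_zero z (h₃.symm.trans h₀)
  · obtain ⟨z, hz⟩ := AdjoinZero.exists_of h₀
    have h₂ := (isPseudoProduct_idem hf).1 (mul_eq_iff.1 hz.symm)
    have h₃ := mul_eq_iff.2
      ((isPseudoProduct_idem he).2 (X.locallyInductive.isCorestriction_comm he hf h₂))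
    exact hz.symm.trans h₃.symm

theorem isPseudoInverse {x a : X.carrier} (h : IsMul x a (plus x)) (h' : IsMul a x (plus a)) :
    IsPseudoInverse (mk x) (mk a) := by
  rw [AdjoinZero.isPseudoInverse_iff]
  change val x * val a * val x = val x ∧ val a * val x * val a = val a
  rw [isMul_mul h, isMul_mul h', isMul_mul (plus_mul_self x), isMul_mul (plus_mul_self a)]
  exact ⟨rfl, rfl⟩

noncomputable instance : InverseSemigroupoid (Pseudo X) where
  existsUnique_pseudoInverse s := by
    obtain ⟨a, h, h'⟩ := X.locallyInductive.exists_inverse X.hasRightInverses s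
    refine ⟨a, isPseudoInverse h h', fun b hb => ?_⟩
    obtain ⟨h₁, h₂⟩ := AdjoinZero.isPseudoInverse_iff.1 (isPseudoInverse h h')
    obtain ⟨h₃, h₄⟩ := AdjoinZero.isPseudoInverse_iff.1 hb
    apply AdjoinZero.of_inj.1
    change AdjoinZero.of s * _ * AdjoinZero.of s = AdjoinZero.of s at h₁
    change _ * AdjoinZero.of s * _ = _ at h₂
    change _ = AdjoinZero.of (mk a)
    generalize AdjoinZero.of s = s, AdjoinZero.of (mk a) = a, AdjoinZero.of b = b at *
    -- This repeats the argument of `inv_unique`, which needs the inverse operation whose uniqueness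
    -- is being established.
    have hl := idem_comm (a := s * a) (b := s * b) (by grind) (by grind)
    have hr := idem_comm (a := a * s) (b := b * s) (by grind) (by grind)
    grind

theorem plus_mk (x : X.carrier) : InverseSemigroupoid.plus (mk x) = mk (plus x) := by
  obtain ⟨a, h, h'⟩ := X.locallyInductive.exists_inverse X.hasRightInverses x
  have : InverseSemigroupoid.inv (mk x) = mk a :=
    (InverseSemigroupoid.existsUnique_pseudoInverse (mk x)).unique
      (InverseSemigroupoid.isPseudoInverse_inv _) (isPseudoInverse h h')
  rw [← AdjoinZero.of_inj, AdjoinZero.of_plus, InverseSemigroup.dom, AdjoinZero.inv_of, this]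
  exact isMul_mul h

theorem dom_val (x : X.carrier) : InverseSemigroup.dom (val x) = val (plus x) := by
  rw [val, ← AdjoinZero.of_plus, plus_mk]; rfl

/-- The original product is the pseudo-product restricted to the pairs with `x ⊗ y⁺ = x`, as in the
definition of `Const`. -/
theorem isMul_iff_val {x y z : X.carrier} :
    IsMul x y z ↔ val x * InverseSemigroup.dom (val y) = val x ∧ val x * val y = val z := by
  rw [dom_val, mul_eq_iff, mul_eq_iff, isPseudoProduct_idem ⟨y, rfl⟩]
  constructor
  · intro h
    exact ⟨isCorestriction_self (comp_plus_iff.2 h.1), h.isPseudoProduct⟩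
  · rintro ⟨h, a, ha, h'⟩
    rwa [IsGreatest.unique h ha]

/-- If `x ≤ y`, then `x⁺y` is defined, lies below `y` and has the same `⁺` as `x`, so it is `x`. -/
theorem le_iff {x y : X.carrier} : x ≤ y ↔ InverseSemigroup.Le (val x) (val y) := by
  rw [InverseSemigroup.Le, dom_val, mul_eq_iff]
  constructor
  · intro h
    have h₁ := X.locallyInductive.plus_le_plus _ _ h
    have h₂ := X.locallyInductive.comp_of_le ⟨x, rfl⟩ ⟨y, rfl⟩ h₁
    obtain ⟨z, hz⟩ : ∃ z, IsMul (plus x) y z := ⟨_, comp_plus_iff.1 h₂, rfl⟩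
    have h₃ := X.locallyInductive.isMul_mono hz (plus_mul_self y) h₁ le_rfl
    obtain rfl := X.locallyInductive.eq_of_plus_eq h h₃ (by rw [hz.plus_eq, plus_plus])
    exact hz.isPseudoProduct
  · rintro ⟨a, ha, h⟩
    have ha' := X.locallyInductive.isCorestriction_comm ⟨x, rfl⟩ ⟨y, rfl⟩ ha
    exact X.locallyInductive.isMul_mono h (plus_mul_self y) ha'.1.1 le_rfl

end Pseudo

/-! ### The bijection on objects -/

theorem PartialMul.ext_isMul {S : Type u} {i j : PartialMul S}
    (h : ∀ s t r : S, @IsMul S i s t r ↔ @IsMul S j s t r) : i = j := by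
  obtain ⟨C, m⟩ := i
  obtain ⟨C', m'⟩ := j
  obtain rfl : C = C' := by
    funext s t
    exact propext ⟨fun hc => ((h s t _).1 ⟨hc, rfl⟩).1, fun hc => ((h s t _).2 ⟨hc, rfl⟩).1⟩
  obtain rfl : m = m' := by
    funext s t hc
    obtain ⟨_, e⟩ := (h s t _).1 ⟨hc, rfl⟩
    exact e.symm
  rfl

theorem InverseSemigroupoid.ext_isMul {S : Type u} {i j : InverseSemigroupoid S}
    (h : ∀ s t r : S, @IsMul S i.toPartialMul s t r ↔ @IsMul S j.toPartialMul s t r) :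
    i = j := by
  obtain @⟨@⟨_, _⟩, _⟩ := i
  obtain @⟨@⟨_, _⟩, _⟩ := j
  obtain rfl := PartialMul.ext_isMul h
  rfl

theorem LeftConstellation.ext_isMul {S : Type u} {i j : LeftConstellation S}
    (h : ∀ s t r : S, @IsMul S i.toPartialMul s t r ↔ @IsMul S j.toPartialMul s t r)
    (h' : ∀ s : S, i.plus s = j.plus s) : i = j := by
  obtain ⟨p, _⟩ := i
  obtain ⟨q, _⟩ := j
  obtain rfl := PartialMul.ext_isMul h
  obtain rfl : p = q := funext h'
  rfl

theorem LIConstRightInv.ext {S : Type u} {i j : LeftConstellation S} {o o' : PartialOrder S}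
    {h₁ : @IsLocallyInductive S i o} {h₂ : @HasRightInverses S i}
    {h₁' : @IsLocallyInductive S j o'} {h₂' : @HasRightInverses S j} (h : i = j) (h' : o = o') :
    @LIConstRightInv.mk S i o h₁ h₂ = @LIConstRightInv.mk S j o' h₁' h₂' := by
  subst h h'; rfl

/-- The li-constellation of an inverse semigroupoid. -/
noncomputable def InvSgpd.const (A : InvSgpd.{u}) : LIConstRightInv.{u} where
  carrier := Const A.carrier
  locallyInductive := Const.isLocallyInductive A.carrier
  hasRightInverses := Const.hasRightInverses A.carrier

/-- The inverse semigroupoid of an li-constellation. -/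
noncomputable def LIConstRightInv.pseudo (X : LIConstRightInv.{u}) : InvSgpd.{u} where
  carrier := Pseudo X

theorem InvSgpd.pseudo_const (A : InvSgpd.{u}) : A.const.pseudo = A := by
  obtain ⟨S, _⟩ := A
  refine congrArg (@InvSgpd.mk S) (InverseSemigroupoid.ext_isMul fun s t r => ?_)
  refine (Pseudo.isMul_iff (X := InvSgpd.const ⟨S⟩)).trans ?_
  exact (Const.isPseudoProduct_iff (S := S)).trans AdjoinZero.of_mul_eq

theorem LIConstRightInv.const_pseudo (X : LIConstRightInv.{u}) : X.pseudo.const = X := by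
  refine LIConstRightInv.ext (LeftConstellation.ext_isMul (fun s t r => ?_) fun s => ?_)
    (PartialOrder.ext fun x y => ?_)
  · exact (Const.mul_eq_iff (S := Pseudo X)).trans Pseudo.isMul_iff_val.symm
  · exact Pseudo.plus_mk s
  · exact (Const.le_iff (S := Pseudo X)).trans Pseudo.le_iff.symm

/-- Inverse semigroupoids correspond to li-constellations with right inverses. -/
noncomputable def objEquiv : InvSgpd.{u} ≃ LIConstRightInv.{u} where
  toFun := InvSgpd.const
  invFun := LIConstRightInv.pseudo
  left_inv := InvSgpd.pseudo_const
  right_inv := LIConstRightInv.const_pseudo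

/-! ### Morphisms and radiants -/

namespace Const

open InverseSemigroup AdjoinZero InverseSemigroupoid

variable {S S' : Type u} [InverseSemigroupoid S] [InverseSemigroupoid S']

theorem isMorphism_iff_val {φ : Const S → Const S'} :
    IsMorphism (S := S) (T := S') φ ↔
      ∀ x y z : Const S, val x * val y = val z → val (φ x) * val (φ y) = val (φ z) :=
  isMorphism_iff

theorem isPremorphism_iff_val {φ : Const S → Const S'} :
    IsPremorphism (S := S) (T := S') φ ↔
      (∀ x y z : Const S, val x * val y = val z → val (φ x) * val (φ y) ≠ 0 ∧
        val (φ x) * val (φ y) = dom (val (φ x)) * val (φ z)) ∧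
      ∀ x : Const S, Le (dom (val (φ x))) (val (φ (LeftConstellation.plus x))) :=
  isPremorphism_iff

/-- Morphisms preserve `x⁺`. -/
theorem map_plus {φ : Const S → Const S'}
    (h : ∀ x y z : Const S, val x * val y = val z → val (φ x) * val (φ y) = val (φ z))
    (x : Const S) : dom (val (φ x)) = val (φ (LeftConstellation.plus x)) := by
  have h₁ := mul_inv_mul (val x)
  have h₀ : val x * (val x)⁻¹ ≠ 0 := left_ne_zero (h₁ ▸ val_ne_zero x)
  obtain ⟨y, hy⟩ := exists_val (right_ne_zero h₀)
  have h₂ := inv_mul_inv (val x)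
  have e₁ := h x y (LeftConstellation.plus x) (by rw [hy, val_plus', dom])
  have e₂ := h (LeftConstellation.plus x) x x (by rw [val_plus', dom_mul_self])
  obtain ⟨z, hz⟩ := exists_val (left_ne_zero (h₂ ▸ hy ▸ val_ne_zero y))
  have e₃ := h y x z (by rw [hz, hy])
  have e₄ := h z y y (by rw [hz, hy, h₂])
  -- The four identities make `φ(x⁻¹)` an inverse of `φ(x)`, so `φ(x)⁺ = φ(x)φ(x⁻¹) = φ(x⁺)`.
  rw [dom, ← eq_inv (a := val (φ x)) (b := val (φ y)) (by rw [e₁, e₂]) (by rw [e₃, e₄]), e₁]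

/-- A radiant respects the corestriction and the constellation product in `xy = (x|y⁺)y`.
Conversely, all the radiant conditions are product equations once `⁺` is preserved. -/
theorem isInductiveRadiant_iff {φ : Const S → Const S'} :
    IsInductiveRadiant φ ↔ IsMorphism (S := S) (T := S') φ := by
  rw [isMorphism_iff_val]
  constructor
  · intro h x y z hxyz
    have hid := dom_idem (val y)
    rw [← val_plus'] at hid
    have hid' : val (φ (LeftConstellation.plus y)) * val (φ (LeftConstellation.plus y)) =
        val (φ (LeftConstellation.plus y)) := by
      rw [← h.map_plus, val_plus', dom_idem]
    rw [← mul_dom_mul] at hxyz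
    obtain ⟨a, ha⟩ := exists_val (left_ne_zero (hxyz ▸ val_ne_zero z))
    have h₁ := h.map_corestriction x _ ⟨y, rfl⟩ a
      ((isCorestriction_iff hid).2 (by rw [val_plus', ha]))
    rw [isCorestriction_iff hid', ← h.map_plus, val_plus'] at h₁
    obtain ⟨h₂, h₃⟩ := (mul_eq_iff (x := a) (y := y) (z := z)).2
      ⟨by rw [ha, mul_assoc, dom_idem], by rw [ha, hxyz]⟩
    obtain ⟨h₄, h₅⟩ := h.map_mul a y h₂
    rw [← h₃, h₅, val_mul, ← h₁, mul_dom_mul]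
  · intro h
    have hp := map_plus h
    refine ⟨fun x y hxy => ?_, fun x => ?_, fun x y hxy => ?_, fun x e he z hz => ?_⟩
    · have := (mul_eq_iff (x := φ x) (y := φ y) (z := φ (mul x y hxy))).2 ⟨?_, ?_⟩
      · obtain ⟨h₁, h₂⟩ := this
        exact ⟨h₁, h₂.symm⟩
      · rw [hp]
        exact h _ _ _ (by rw [val_plus']; exact hxy)
      · exact h _ _ _ (val_mul hxy).symm
    · rw [← val_inj, val_plus', hp]
    · rw [le_iff] at *
      rw [Le, hp]
      exact h _ _ _ (by rw [val_plus']; exact hxy)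
    · rw [isCorestriction_iff (mem_Plus.1 he)] at hz
      exact (isCorestriction_iff (h _ _ _ (mem_Plus.1 he))).2 (h _ _ _ hz)

/-! ### Premorphisms and preradiants -/

section Premorphism

variable {φ : Const S → Const S'}

theorem map_idem (h : ∀ x y z : Const S, val x * val y = val z →
      val (φ x) * val (φ y) = dom (val (φ x)) * val (φ z)) {e : Const S}
    (he : val e * val e = val e) : val (φ e) * val (φ e) = val (φ e) := by
  rw [h e e e he, dom_mul_self]

/-- A premorphism is multiplicative when the left factor is idempotent. With `z = ex`, the
premorphism identity gives `φ(e)φ(x) = φ(e)φ(z)`, and `φ(e)` is absorbed by `φ(z) = φ(z⁺)φ(z)`. -/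
theorem map_idem_mul (h : ∀ x y z : Const S, val x * val y = val z →
      val (φ x) * val (φ y) = dom (val (φ x)) * val (φ z))
    (hp : ∀ x : Const S, Le (dom (val (φ x))) (val (φ (LeftConstellation.plus x))))
    {e x z : Const S} (he : val e * val e = val e) (hz : val e * val x = val z) :
    val (φ e) * val (φ x) = val (φ z) := by
  have hpz := (le_iff_of_idem (dom_idem _)).1 (hp z)
  have hpi := map_idem h (e := LeftConstellation.plus z) (by rw [val_plus', dom_idem])
  have h₁ : val (φ (LeftConstellation.plus z)) * val (φ z) = val (φ z) := by
    rw [InverseSemigroup.idem_comm _ _ (dom_idem _) hpi] at hpz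
    rw [← dom_mul_self (val (φ z)), ← mul_assoc, hpz]
  have h₂ := map_idem h he
  have h₃ := h e (LeftConstellation.plus z) (LeftConstellation.plus z) (by
    rw [val_plus', ← hz, dom_idem_mul he, ← mul_assoc, he])
  rw [dom_of_idem h₂] at h₃
  have h₄ := h e x z hz
  rw [dom_of_idem h₂] at h₄
  -- The order of the factors matters: applied to `ez⁺ = z⁺` the identity is a tautology, but
  -- applied to `z⁺e = z⁺` it gives `φ(z⁺)φ(e) = φ(z⁺)`.
  have h₅ := h (LeftConstellation.plus z) e (LeftConstellation.plus z) (by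
    rw [val_plus', ← hz, dom_idem_mul he]
    have := dom_comm he (val x)
    grind)
  rw [dom_of_idem hpi, hpi, InverseSemigroup.idem_comm _ _ hpi h₂] at h₅
  rw [h₄, ← h₁, ← mul_assoc, h₅]

theorem map_le (h : ∀ x y z : Const S, val x * val y = val z →
      val (φ x) * val (φ y) = dom (val (φ x)) * val (φ z))
    (hp : ∀ x : Const S, Le (dom (val (φ x))) (val (φ (LeftConstellation.plus x))))
    {x y : Const S} (hxy : x ≤ y) : φ x ≤ φ y := by
  rw [le_iff] at *
  rw [Le, ← val_plus'] at hxy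
  have hid := dom_idem (val x)
  rw [← val_plus'] at hid
  rw [← map_idem_mul h hp hid hxy]
  exact le_of_idem_mul (map_idem h hid) _

theorem isInductivePreradiant_iff :
    IsInductivePreradiant φ ↔ IsPremorphism (S := S) (T := S') φ := by
  rw [isPremorphism_iff_val]
  constructor
  · intro h
    have hp : ∀ x : Const S, Le (dom (val (φ x))) (val (φ (LeftConstellation.plus x))) := by
      intro x
      rw [← val_plus', ← le_iff]
      exact h.plus_le x
    have hm : ∀ x y z : Const S, val x * dom (val y) = val x → val x * val y = val z →
        val (φ x) * val (φ y) ≠ 0 ∧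
          val (φ x) * val (φ y) = dom (val (φ x)) * val (φ z) := by
      intro x y z h₁ h₂
      obtain ⟨hc, rfl⟩ := mul_eq_iff.2 ⟨h₁, h₂⟩
      obtain ⟨r, h₃, h₄⟩ := h.map_mul x y hc
      rw [isPseudoProduct_iff, val_plus'] at *
      rw [h₃, h₄]
      exact ⟨val_ne_zero r, rfl⟩
    have hidem : ∀ e : Const S, val e * val e = val e →
        val (φ e) * val (φ e) = val (φ e) := by
      intro e he
      rw [(hm e e e (by rw [dom_of_idem he, he]) he).2, dom_mul_self]
    have hplus : ∀ x : Const S,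
        val (φ (LeftConstellation.plus x)) * val (φ x) = val (φ x) := by
      intro x
      have hi := hidem (LeftConstellation.plus x) (by rw [val_plus', dom_idem])
      have := (le_iff_of_idem (dom_idem _)).1 (hp x)
      rw [InverseSemigroup.idem_comm _ _ (dom_idem _) hi] at this
      calc _ = val (φ (LeftConstellation.plus x)) * dom (val (φ x)) * val (φ x) := by
            rw [mul_assoc, dom_mul_self]
        _ = _ := by rw [this, dom_mul_self]
    refine ⟨fun x y z hxyz => ?_, hp⟩
    have hid := dom_idem (val y)
    rw [← val_plus'] at hid
    rw [← mul_dom_mul] at hxyz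
    obtain ⟨a, ha⟩ := exists_val (left_ne_zero (hxyz ▸ val_ne_zero z))
    have h₁ := h.map_corestriction x _ ⟨y, rfl⟩ a
      ((isCorestriction_iff hid).2 (by rw [val_plus', ha]))
    rw [isCorestriction_iff (hidem _ hid)] at h₁
    obtain ⟨h₂, h₃⟩ := hm a y z (by rw [ha, mul_assoc, dom_idem]) (by rw [ha, hxyz])
    rw [← h₁, mul_assoc, hplus] at h₂ h₃
    refine ⟨h₂, ?_⟩
    -- So far `φ(x)φ(y) = φ(a)⁺φ(z)` with `a = x|y⁺`. As `a` is also the restriction `a⁺|x`, the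
    -- condition on restrictions gives `φ(a)⁺ = φ(a⁺)φ(x)⁺`; the factor `φ(a⁺) = φ(z⁺)` is then
    -- absorbed by `φ(z)`.
    have hax : a ≤ x := by rw [le_iff, ha]; exact le_of_mul_idem (dom_idem _) _
    have hax' : LeftConstellation.plus a ≤ LeftConstellation.plus x :=
      (isLocallyInductive S).plus_le_plus _ _ hax
    have h₄ := h.plus_map_restriction x _ ⟨a, rfl⟩ hax' a ⟨hax, rfl⟩
    have hi := dom_idem (val (φ x))
    rw [← val_plus'] at hi
    rw [isCorestriction_iff hi, val_plus', val_plus'] at h₄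
    have hi' := hidem (LeftConstellation.plus a) (by rw [val_plus', dom_idem])
    have haz : LeftConstellation.plus a = LeftConstellation.plus z := by
      rw [← val_inj, val_plus', val_plus', ← hxyz, ← ha, ← dom_mul_dom, ha, mul_assoc, dom_idem]
    rw [h₃, h₁, ← h₄, dom_comm hi', mul_assoc, haz, hplus]
  · rintro ⟨hm, hp⟩
    have h := fun x y z hz => (hm x y z hz).2
    refine ⟨fun x y hxy => ?_, fun x => ?_, fun x y hxy => map_le h hp hxy,
      fun x e he z hz => ?_, fun x e he hle z hz => ?_⟩
    · obtain ⟨h₁, h₂⟩ := hm x y _ (val_mul hxy).symm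
      obtain ⟨r, hr⟩ := exists_val h₁
      refine ⟨r, isPseudoProduct_iff.2 hr.symm, isPseudoProduct_iff.2 ?_⟩
      rw [hr, h₂, val_plus']
    · rw [le_iff, val_plus']
      exact hp x
    · have he := mem_Plus.1 he
      rw [isCorestriction_iff he] at hz
      rw [isCorestriction_iff (map_idem h he), h x e z hz]
      have hzx : z ≤ x := by rw [le_iff, ← hz]; exact le_of_mul_idem he _
      exact (le_iff.1 (map_le h hp hzx)).mul_dom_le
    · have he := mem_Plus.1 he
      rw [isRestriction_iff hle] at hz
      have hi := dom_idem (val (φ x))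
      rw [← val_plus'] at hi
      rw [isCorestriction_iff hi, val_plus', val_plus', ← map_idem_mul h hp he hz,
        dom_idem_mul (map_idem h he)]

end Premorphism

/-! ### Identities and composition -/

theorem isMorphism_comp {S'' : Type u} [InverseSemigroupoid S''] {φ : S → S'} {ψ : S' → S''}
    (h : IsMorphism φ) (h' : IsMorphism ψ) : IsMorphism (ψ ∘ φ) := by
  rw [isMorphism_iff] at *
  exact fun s t r e => h' _ _ _ (h _ _ _ e)

theorem isPremorphism_id : IsPremorphism (id : S → S) := by
  rw [isPremorphism_iff]
  refine ⟨fun s t r e => ⟨?_, ?_⟩, fun s => ?_⟩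
  · exact e ▸ of_ne_zero r
  · rw [id, id, id, ← e, ← mul_assoc, dom_mul_self]
  · rw [id, id, of_plus]; exact Le.refl _

theorem isPremorphism_comp {S'' : Type u} [InverseSemigroupoid S''] {φ : Const S → Const S'}
    {ψ : Const S' → Const S''} (h : IsPremorphism (S := S) (T := S') φ)
    (h' : IsPremorphism (S := S') (T := S'') ψ) :
    IsPremorphism (S := S) (T := S'') (ψ ∘ φ) := by
  rw [isPremorphism_iff_val] at h h'
  obtain ⟨h₁, h₂⟩ := h
  obtain ⟨h₁', h₂'⟩ := h'
  have hm := fun x y z hz => (h₁' x y z hz).2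
  refine isPremorphism_iff_val.2 ⟨fun x y z hz => ?_, fun x => ?_⟩
  · obtain ⟨h₃, h₄⟩ := h₁ x y z hz
    obtain ⟨w, hw⟩ := exists_val h₃
    obtain ⟨h₅, h₆⟩ := h₁' _ _ _ hw.symm
    refine ⟨h₅, h₆.trans ?_⟩
    have hid := dom_idem (val (φ x))
    rw [← val_plus'] at hid
    -- Here `w = φ(x)⁺φ(z)`, so `ψ(w) = ψ(φ(x)⁺)ψ(φ(z))`; the first factor is absorbed by
    -- `ψ(φ(x))⁺`, which lies below it.
    have h₇ := map_idem_mul hm h₂' (e := LeftConstellation.plus (φ x)) (x := φ z) (z := w) hid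
      (by rw [val_plus', hw, h₄])
    have h₈ := (le_iff_of_idem (dom_idem _)).1 (h₂' (φ x))
    rw [← h₇, ← mul_assoc, h₈]; rfl
  · refine (h₂' _).trans (le_iff.1 (map_le hm h₂' ?_))
    rw [le_iff, val_plus']
    exact h₂ x

end Const

/-! ### Isomorphisms of categories -/

/-- A fully faithful functor that is bijective on objects gives an isomorphism in `Cat`. -/
theorem nonempty_iso_of_objEquiv {C D : Type (u + 1)} [Category.{u} C] [Category.{u} D]
    (F : C ⥤ D) [F.Full] [F.Faithful] (e : C ≃ D) (h : ∀ X, F.obj X = e X) :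
    Nonempty (Cat.of C ≅ Cat.of D) := by
  have h' : ∀ Y, F.obj (e.symm Y) = Y := fun Y => by rw [h, e.apply_symm_apply]
  let G : D ⥤ C :=
    { obj := e.symm
      map := fun {Y Z} f => F.preimage (eqToHom (h' Y) ≫ f ≫ eqToHom (h' Z).symm)
      map_id := fun Y => F.map_injective (by simp)
      map_comp := fun f g => F.map_injective (by simp) }
  have h₁ : F ⋙ G = 𝟭 C := by
    refine CategoryTheory.Functor.ext (fun X => ?_) fun X Y f => F.map_injective ?_
    · simp [G, h]
    · simp [G, eqToHom_map]
  have h₂ : G ⋙ F = 𝟭 D :=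
    CategoryTheory.Functor.ext h' fun X Y f => by simp [G]
  exact ⟨⟨F.toCatHom, G.toCatHom, congrArg Functor.toCatHom h₁, congrArg Functor.toCatHom h₂⟩⟩

/-- A bijection of objects with bijections of their underlying sets that identify the chosen
functions gives an isomorphism of categories. -/
theorem FunctionClass.nonempty_iso {K K' : FunctionClass.{u}} (hK : K.FormsCategory)
    (hK' : K'.FormsCategory) (e : K.Obj ≃ K'.Obj) (c : ∀ X, K.carrier X ≃ K'.carrier (e X))
    (h : ∀ (X Y : K.Obj) (f : K.carrier X → K.carrier Y),
      K.IsHom f ↔ K'.IsHom (X := e X) (Y := e Y) (c Y ∘ f ∘ (c X).symm)) :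
    Nonempty (hK.cat ≅ hK'.cat) := by
  let F : hK.cat ⥤ hK'.cat :=
    { obj := e
      map := fun {X Y} f => ⟨c Y ∘ f.1 ∘ (c X).symm, (h X Y f.1).1 f.2⟩
      map_id := fun X => Subtype.ext (funext fun x => (c X).apply_symm_apply x)
      map_comp := fun {X Y Z} f g => Subtype.ext (funext fun x =>
        congrArg (fun y => c Z (g.1 y)) ((c Y).symm_apply_apply (f.1 ((c X).symm x))).symm) }
  have : F.Faithful := ⟨fun {X Y f g} hfg => Subtype.ext (funext fun x => by
    have h₁ := congrFun (congrArg Subtype.val hfg) (c X x)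
    have h₂ : f.1 ((c X).symm (c X x)) = g.1 ((c X).symm (c X x)) := (c Y).injective h₁
    rwa [(c X).symm_apply_apply] at h₂)⟩
  have : F.Full := ⟨fun {X Y} g => by
    have key : c Y ∘ ((c Y).symm ∘ g.1 ∘ c X) ∘ (c X).symm = g.1 := by
      funext x
      simp
    exact ⟨⟨(c Y).symm ∘ g.1 ∘ c X, (h X Y _).2 (key.symm ▸ g.2)⟩, Subtype.ext key⟩⟩
  exact nonempty_iso_of_objEquiv (C := hK.cat) (D := hK'.cat) F e fun _ => rfl

/-! ### The four categories -/

theorem invSgpdMor_formsCategory : invSgpdMor.{u}.FormsCategory where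
  id_isHom _ := fun _ _ h => ⟨h, rfl⟩
  comp_isHom {X Y Z} _ _ h h' := by
    change InvSgpd at X Y Z
    exact Const.isMorphism_comp (S := X.carrier) (S' := Y.carrier) (S'' := Z.carrier) h h'

theorem invSgpdPremor_formsCategory : invSgpdPremor.{u}.FormsCategory where
  id_isHom (X : InvSgpd) := Const.isPremorphism_id (S := X.carrier)
  comp_isHom {X Y Z} _ _ h h' := by
    change InvSgpd at X Y Z
    exact Const.isPremorphism_comp (S := X.carrier) (S' := Y.carrier) (S'' := Z.carrier) h h'

/-- Every li-constellation with right inverses comes from an inverse semigroupoid, so closure under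
composition is inherited from morphisms. -/
theorem liConstRadiant_formsCategory : liConstRadiant.{u}.FormsCategory where
  id_isHom X := by
    obtain ⟨A, rfl⟩ := objEquiv.surjective X
    exact (Const.isInductiveRadiant_iff (S := A.carrier) (S' := A.carrier)).2
      (invSgpdMor_formsCategory.id_isHom A)
  comp_isHom {X Y Z} f g h h' := by
    obtain ⟨A, rfl⟩ := objEquiv.surjective X
    obtain ⟨B, rfl⟩ := objEquiv.surjective Y
    obtain ⟨C, rfl⟩ := objEquiv.surjective Z
    exact (Const.isInductiveRadiant_iff (S := A.carrier) (S' := C.carrier)).2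
      (invSgpdMor_formsCategory.comp_isHom (X := A) (Y := B) (Z := C) f g
        ((Const.isInductiveRadiant_iff (S := A.carrier) (S' := B.carrier)).1 h)
        ((Const.isInductiveRadiant_iff (S := B.carrier) (S' := C.carrier)).1 h'))

theorem liConstPreradiant_formsCategory : liConstPreradiant.{u}.FormsCategory where
  id_isHom X := by
    obtain ⟨A, rfl⟩ := objEquiv.surjective X
    exact (Const.isInductivePreradiant_iff (S := A.carrier) (S' := A.carrier)).2
      (invSgpdPremor_formsCategory.id_isHom A)
  comp_isHom {X Y Z} f g h h' := by
    obtain ⟨A, rfl⟩ := objEquiv.surjective X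
    obtain ⟨B, rfl⟩ := objEquiv.surjective Y
    obtain ⟨C, rfl⟩ := objEquiv.surjective Z
    exact (Const.isInductivePreradiant_iff (S := A.carrier) (S' := C.carrier)).2
      (invSgpdPremor_formsCategory.comp_isHom (X := A) (Y := B) (Z := C) f g
        ((Const.isInductivePreradiant_iff (S := A.carrier) (S' := B.carrier)).1 h)
        ((Const.isInductivePreradiant_iff (S := B.carrier) (S' := C.carrier)).1 h'))

end ESN

theorem mainTheorem6 :
    (∃ (hS : ESN.invSgpdMor.{u}.FormsCategory) (hT : ESN.liConstRadiant.{u}.FormsCategory),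
      Nonempty (hS.cat ≅ hT.cat)) ∧
    (∃ (hS : ESN.invSgpdPremor.{u}.FormsCategory) (hT : ESN.liConstPreradiant.{u}.FormsCategory),
      Nonempty (hS.cat ≅ hT.cat)) :=
  ⟨⟨ESN.invSgpdMor_formsCategory, ESN.liConstRadiant_formsCategory,
    -- The bijections of underlying sets are identities, since `InvSgpd.const` keeps the carrier.
    ESN.FunctionClass.nonempty_iso _ _ ESN.objEquiv (fun _ => .refl _)
      fun (A B : ESN.InvSgpd) _ =>
      (ESN.Const.isInductiveRadiant_iff (S := A.carrier) (S' := B.carrier)).symm⟩,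
  ⟨ESN.invSgpdPremor_formsCategory, ESN.liConstPreradiant_formsCategory,
    ESN.FunctionClass.nonempty_iso _ _ ESN.objEquiv (fun _ => .refl _)
      fun (A B : ESN.InvSgpd) _ =>
      (ESN.Const.isInductivePreradiant_iff (S := A.carrier) (S' := B.carrier)).symm⟩⟩
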